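/- Let $d$ be even and let $G=(V,E)$ be the $d$-regular tree (a connected acyclic graph in which every vertex has degree $d$). Attach to every vertex $v$ an initial spin $\sigma_0(v)$, uniform on $\{-1,+1\}$, a Poisson clock of rate $1$ with ring times $\tau_1(v)<\tau_2(v)<\cdots$, and coins $\beta_1(v),\beta_2(v),\dots$, uniform on $\{-1,+1\}$; all initial spins, clocks and coins are independent. In the zero-temperature Glauber dynamics $(\sigma_t)_{t\ge 0}$ on $G$ the spin at $v$ can change only at the ring times of $v$. When the clock of $v$ rings for the $k$-th time, let $\Delta=2\sum_{y\sim v}\sigma(v)\sigma(y)$, where $\sigma$ is the configuration just before the ring (this is the change of the energy $-\sum_{x\sim y}\sigma(x)\sigma(y)$ that a flip at $v$ would cause). If $\Delta<0$, the spin at $v$ is flipped; if $\Delta>0$, it is left unchanged; if $\Delta=0$, the new spin at $v$ is $\beta_k(v)$, so that the spin flips with probability $1/2$. Then almost surely the initial spins, ring times and coins determine a unique evolution $(\sigma_t)_{t\ge0}$ of this dynamics, and it does not freeze: the pointwise limit $\lim_{t\to\infty}\sigma_t$ does not exist, and some vertex flips its spin infinitely often. -/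

import Mathlib

open MeasureTheory ProbabilityTheory Filter Topology
open scoped NNReal

/-- The spin space `{-1, +1}`, realised as the units of `ℤ`. -/
abbrev Spin : Type := ℤˣ

instance spin_measurableSingletonClass : MeasurableSingletonClass Spin where
  measurableSet_singleton a := by
    refine ⟨{(a : ℤ)}, measurableSet_singleton _, ?_⟩
    ext b
    simp [Units.ext_iff]

/-- The symmetric Bernoulli law on `{-1, +1}`. -/
noncomputable def fairSpin : Measure Spin := (PMF.uniformOfFintype Spin).toMeasure

instance fairSpin_isProbabilityMeasure : IsProbabilityMeasure fairSpin := by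
  unfold fairSpin; infer_instance

instance expMeasure_one_isProbabilityMeasure : IsProbabilityMeasure (expMeasure 1) :=
  isProbabilityMeasure_expMeasure one_pos

/-- The sample space: each vertex carries an initial spin, the waiting times between consecutive
rings of its clock, and the outcomes of its coin tosses (one for each ring). -/
abbrev GlauberSample (V : Type*) : Type _ := V → Spin × (ℕ → ℝ) × (ℕ → Spin)

/-- The joint law of all initial spins, clocks and coins: everything is independent, the initial
spins and the coins are symmetric, and the waiting times are exponential of rate `1`, so that each
vertex carries a rate `1` Poisson clock. -/
noncomputable def glauberLaw (V : Type*) : Measure (GlauberSample V) :=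
  Measure.infinitePi fun _ : V =>
    fairSpin.prod ((Measure.infinitePi fun _ : ℕ => expMeasure 1).prod
      (Measure.infinitePi fun _ : ℕ => fairSpin))

namespace GlauberSample

variable {V : Type*}

/-- The initial spin of `v`. -/
def init (w : GlauberSample V) (v : V) : Spin := (w v).1

/-- The time of ring number `k` (counted from `0`) of the clock at `v`. -/
noncomputable def ringTime (w : GlauberSample V) (v : V) (k : ℕ) : ℝ :=
  ∑ i ∈ Finset.range (k + 1), (w v).2.1 i

/-- The coin attached to ring number `k` of the clock at `v`. -/
def coin (w : GlauberSample V) (v : V) (k : ℕ) : Spin := (w v).2.2 k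

end GlauberSample

/-- The change of the energy `-∑_{x ∼ y} σ x σ y` caused by flipping the spin at `v`. -/
def energyChange {V : Type*} (G : SimpleGraph V) [G.LocallyFinite] (σ : V → Spin) (v : V) : ℤ :=
  2 * ∑ y ∈ G.neighborFinset v, (σ v : ℤ) * (σ y : ℤ)

/-- The spin at `v` after a ring at `v` that finds the configuration `σ`, with coin `b`: flip if
this lowers the energy, keep the spin if a flip would raise the energy, and take the value of the
coin if a flip leaves the energy unchanged. -/
def updatedSpin {V : Type*} (G : SimpleGraph V) [G.LocallyFinite] (σ : V → Spin) (v : V)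
    (b : Spin) : Spin :=
  if energyChange G σ v < 0 then -σ v
  else if 0 < energyChange G σ v then σ v
  else b

/-- `σ` is an evolution of zero-temperature Glauber dynamics on `G` driven by the sample `w`: it
starts from the initial spins, the spin at `v` does not change during a time interval without a
ring at `v`, and at a ring at `v` it is updated according to the configuration just before. -/
structure IsGlauberEvolution {V : Type*} (G : SimpleGraph V) [G.LocallyFinite]
    (w : GlauberSample V) (σ : ℝ≥0 → V → Spin) : Prop where
  start : ∀ v, σ 0 v = w.init v
  const : ∀ v (s t : ℝ≥0), s ≤ t → (∀ k, w.ringTime v k ∉ Set.Ioc (s : ℝ) (t : ℝ)) →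
    σ t v = σ s v
  ring : ∀ v k (t : ℝ≥0), w.ringTime v k = t →
    ∀ᶠ s in 𝓝[<] t, σ t v = updatedSpin G (σ s) v (w.coin v k)

/-- The evolution freezes: `σ t` converges pointwise as `t → ∞`. -/
def Freezes {V : Type*} (σ : ℝ≥0 → V → Spin) : Prop :=
  ∃ σ_lim : V → Spin, ∀ v, ∀ᶠ t in atTop, σ t v = σ_lim v

/-- The times at which the spin at `v` flips, i.e. differs from its value just before. -/
def flipTimes {V : Type*} (σ : ℝ≥0 → V → Spin) (v : V) : Set ℝ≥0 :=
  {t | ∃ᶠ s in 𝓝[<] t, σ s v ≠ σ t v}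

/-! Existence and uniqueness. Record only the spin of each vertex after its k-th ring. The spin
produced by a ring is a function of the coin and of finitely many earlier recorded spins, so
everything is determined once the relation `SpinDep` is well founded. An infinite descending chain
would give ring times decreasing to a limit. In a short enough window around that limit, the
vertices that ring form a subcritical percolation: simple ringing paths are almost surely bounded in
length, which confines the chain to finitely many rings (`wellFounded_spinDep`). Well-founded
induction also shows that the dynamics is monotone in external fields (`IsSkeleton.le`).

No freezing. Suppose that every spin settles. Fair coins rule out ties in the limit
(`sum_ne_zero_of_settles`). If almost surely no edge has opposite limits, the limit is a consensus.
This has probability zero: settling is approximated, uniformly in the vertex, by local events of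
probability 1/2, which are independent on distant balls (`glauberLaw_consensus`).

Otherwise some edge has limits -1 and 1 with positive probability, so the root of a branch can
settle at 1 although its parent is eventually -1 (`exists_delayField_pos`). If this happens below
every child of a root that starts at 1 and stays quiet long enough, then all children settle at 1
and outweigh the parent of the root. Hence, when d is at least 4, a root can settle at 1 even under
the constant field -1 (`branchSet_neg_one_ne_zero`), that is, whatever happens outside its branch;
by symmetry the same holds for -1.

Since d is even, a vertex has an odd number 2h+1 of children. Force the grandchildren of a vertex v
so that its first child sees net field 1 from below and its second sees -1. Whichever value v
settles at, one of these two children is then tied forever, a contradiction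
(`not_settles_of_blinkSet`). Such configurations occur independently in infinitely many disjoint
subtrees, so one of them occurs almost surely. The degrees 0 and 2 are handled directly in
`ae_not_settles`. -/

/-! ### The embedded chain of spins between rings -/

section Skeleton

variable {I J : Type*}

/-- The number of rings at `v` up to and including time `t`. -/
noncomputable def ringCount (w : GlauberSample I) (v : I) (t : ℝ) : ℕ :=
  sInf {k | t < w.ringTime v k}

/-- The spin chosen by a ring in the local field `h`, with coin `b`. -/
def heatBath (h : ℤ) (b : Spin) : Spin := if 0 < h then 1 else if h < 0 then -1 else b

/-- The field felt by `v` at time `t`, when `a y k` is the spin of `y` after `k` rings and `e` is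
an external field. -/
noncomputable def localField (nb : I → Finset I) (e : I → ℝ → ℤ) (w : GlauberSample I)
    (a : I → ℕ → Spin) (v : I) (t : ℝ) : ℤ :=
  ∑ y ∈ nb v, (a y (ringCount w y t) : ℤ) + e v t

/-- `a v k` is the spin of `v` after its first `k` rings, in the dynamics with neighbourhoods `nb`
and external field `e`. -/
structure IsSkeleton (nb : I → Finset I) (e : I → ℝ → ℤ) (w : GlauberSample I)
    (a : I → ℕ → Spin) : Prop where
  zero : ∀ v, a v 0 = w.init v
  succ : ∀ v k, a v (k + 1) = heatBath (localField nb e w a v (w.ringTime v k)) (w.coin v k)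

/-- Picard iteration for `IsSkeleton`. -/
noncomputable def approx (nb : I → Finset I) (e : I → ℝ → ℤ) (w : GlauberSample I) :
    ℕ → I → ℕ → Spin
  | 0, v, _ => w.init v
  | _ + 1, v, 0 => w.init v
  | n + 1, v, k + 1 =>
    heatBath (localField nb e w (approx nb e w n) v (w.ringTime v k)) (w.coin v k)

/-- `SpinDep nb w p q`: the spin encoded by `p` is consulted in order to compute that of `q`. -/
def SpinDep (nb : I → Finset I) (w : GlauberSample I) (p q : I × ℕ) : Prop :=
  p.1 ∈ nb q.1 ∧ ∃ k, q.2 = k + 1 ∧ p.2 = ringCount w p.1 (w.ringTime q.1 k)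

lemma Spin.eq_neg_of_ne {a b : Spin} (h : a ≠ b) : a = -b := by
  rcases Int.units_eq_one_or a with rfl | rfl <;> rcases Int.units_eq_one_or b with rfl | rfl <;>
    simp_all

lemma Spin.neg_one_le (a : Spin) : (-1 : ℤ) ≤ a := by
  rcases Int.units_eq_one_or a with rfl | rfl <;> simp

lemma Spin.le_one (a : Spin) : (a : ℤ) ≤ 1 := by
  rcases Int.units_eq_one_or a with rfl | rfl <;> simp

lemma Spin.ne_neg (a : Spin) : a ≠ -a := by
  rcases Int.units_eq_one_or a with rfl | rfl <;> decide

lemma Spin.eq_one_of_le {a : Spin} (h : (1 : ℤ) ≤ a) : a = 1 := by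
  rcases Int.units_eq_one_or a with rfl | rfl
  · rfl
  · simp at h

/-- This is the source of attractiveness: with a common coin the update is monotone in the field. -/
lemma heatBath_mono {h h' : ℤ} (hh : h ≤ h') (b : Spin) :
    (heatBath h b : ℤ) ≤ heatBath h' b := by
  unfold heatBath
  have h1 := Spin.neg_one_le b
  have h2 := Spin.le_one b
  split_ifs <;> first | omega | simp_all

lemma heatBath_neg (h : ℤ) (b : Spin) : heatBath (-h) (-b) = -heatBath h b := by
  unfold heatBath
  split_ifs <;> first | omega | simp

lemma heatBath_of_pos {h : ℤ} (hh : 0 < h) (b : Spin) : heatBath h b = 1 := by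
  simp [heatBath, hh]

lemma heatBath_of_neg {h : ℤ} (hh : h < 0) (b : Spin) : heatBath h b = -1 := by
  simp [heatBath, hh, hh.le]

lemma heatBath_zero (b : Spin) : heatBath 0 b = b := by
  simp [heatBath]

lemma localField_congr {nb : I → Finset I} {e : I → ℝ → ℤ} {w : GlauberSample I}
    {a b : I → ℕ → Spin} {v : I} {t : ℝ}
    (h : ∀ y ∈ nb v, a y (ringCount w y t) = b y (ringCount w y t)) :
    localField nb e w a v t = localField nb e w b v t := by
  unfold localField
  rw [Finset.sum_congr rfl fun y hy => by rw [h y hy]]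

/-- Well-founded induction along `SpinDep`: both dynamics share clocks and coins, so an ordering of
the consulted spins passes through `heatBath_mono`. The fields need to be comparable only at ring
times. -/
lemma IsSkeleton.le {nb : I → Finset I} {e e' : I → ℝ → ℤ} {w : GlauberSample I}
    {a a' : I → ℕ → Spin} (hw : WellFounded (SpinDep nb w)) (ha : IsSkeleton nb e w a)
    (ha' : IsSkeleton nb e' w a') (he : ∀ v k, e v (w.ringTime v k) ≤ e' v (w.ringTime v k))
    (v : I) (k : ℕ) : (a v k : ℤ) ≤ a' v k := by
  suffices h : ∀ p : I × ℕ, (a p.1 p.2 : ℤ) ≤ a' p.1 p.2 from h (v, k)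
  intro p
  induction p using hw.induction with
  | _ p ih =>
  obtain ⟨v, k⟩ := p
  cases k with
  | zero => simp [ha.zero, ha'.zero]
  | succ k =>
    simp only [ha.succ, ha'.succ]
    refine heatBath_mono (add_le_add (Finset.sum_le_sum fun y hy => ?_) (he v k)) _
    exact ih (y, _) ⟨hy, k, rfl, rfl⟩

lemma IsSkeleton.unique {nb : I → Finset I} {e : I → ℝ → ℤ} {w : GlauberSample I}
    {a a' : I → ℕ → Spin} (hw : WellFounded (SpinDep nb w)) (ha : IsSkeleton nb e w a)
    (ha' : IsSkeleton nb e w a') : a = a' := by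
  funext v k
  exact Units.ext (le_antisymm (ha.le hw ha' (fun _ _ => le_rfl) v k)
    (ha'.le hw ha (fun _ _ => le_rfl) v k))

/-- Each update consults finitely many spins; one iteration after all of these have stabilised, the
updated spin is stable too. -/
lemma exists_eventually_approx_eq {nb : I → Finset I} {e : I → ℝ → ℤ} {w : GlauberSample I}
    (hw : WellFounded (SpinDep nb w)) (v : I) (k : ℕ) :
    ∃ c, ∀ᶠ n in atTop, approx nb e w n v k = c := by
  suffices h : ∀ p : I × ℕ, ∃ c, ∀ᶠ n in atTop, approx nb e w n p.1 p.2 = c from h (v, k)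
  intro p
  induction p using hw.induction with
  | _ p ih =>
  obtain ⟨v, k⟩ := p
  cases k with
  | zero => exact ⟨w.init v, .of_forall fun n => by cases n <;> rfl⟩
  | succ k =>
    have ih' : ∀ y : I, ∃ c, y ∈ nb v → ∀ᶠ n in atTop,
        approx nb e w n y (ringCount w y (w.ringTime v k)) = c := by
      intro y
      by_cases hy : y ∈ nb v
      · obtain ⟨c, hc⟩ := ih (y, ringCount w y (w.ringTime v k)) ⟨hy, k, rfl, rfl⟩
        exact ⟨c, fun _ => hc⟩
      · exact ⟨1, fun h => absurd h hy⟩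
    choose c hc using ih'
    have hall := (eventually_all_finset (nb v)).2 hc
    refine ⟨heatBath (localField nb e w (fun y _ => c y) v (w.ringTime v k)) (w.coin v k), ?_⟩
    obtain ⟨N, hN⟩ := eventually_atTop.1 hall
    refine eventually_atTop.2 ⟨N + 1, fun n hn => ?_⟩
    obtain ⟨m, rfl⟩ : ∃ m, n = m + 1 := ⟨n - 1, by omega⟩
    simp only [approx]
    rw [localField_congr (b := fun y _ => c y) (hN m (by omega))]

open scoped Classical in
/-- The limit of the Picard iteration. -/
noncomputable def skeleton (nb : I → Finset I) (e : I → ℝ → ℤ) (w : GlauberSample I) (v : I)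
    (k : ℕ) : Spin :=
  if ∀ᶠ n in atTop, approx nb e w n v k = 1 then 1 else -1

lemma eventually_approx_eq_skeleton {nb : I → Finset I} {e : I → ℝ → ℤ} {w : GlauberSample I}
    (hw : WellFounded (SpinDep nb w)) (v : I) (k : ℕ) :
    ∀ᶠ n in atTop, approx nb e w n v k = skeleton nb e w v k := by
  obtain ⟨c, hc⟩ := exists_eventually_approx_eq (e := e) hw v k
  unfold skeleton
  split_ifs with h
  · exact h
  · rcases Int.units_eq_one_or c with rfl | rfl
    · exact absurd hc h
    · exact hc

lemma eventually_approx_eq_iff {nb : I → Finset I} {e : I → ℝ → ℤ} {w : GlauberSample I}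
    (hw : WellFounded (SpinDep nb w)) (v : I) (k : ℕ) (s : Spin) :
    (∀ᶠ n in atTop, approx nb e w n v k = s) ↔ skeleton nb e w v k = s := by
  have h := eventually_approx_eq_skeleton (e := e) hw v k
  refine ⟨fun hs => ?_, fun hs => hs ▸ h⟩
  obtain ⟨n, hn, hn'⟩ := (h.and hs).exists
  rw [← hn, hn']

lemma isSkeleton_skeleton {nb : I → Finset I} {e : I → ℝ → ℤ} {w : GlauberSample I}
    (hw : WellFounded (SpinDep nb w)) : IsSkeleton nb e w (skeleton nb e w) where
  zero v := by
    obtain ⟨n, hn⟩ := (eventually_approx_eq_skeleton (e := e) hw v 0).exists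
    rw [← hn]
    cases n <;> rfl
  succ v k := by
    have h : ∀ᶠ n in atTop, ∀ y ∈ nb v, approx nb e w n y (ringCount w y (w.ringTime v k)) =
        skeleton nb e w y (ringCount w y (w.ringTime v k)) :=
      (eventually_all_finset (nb v)).2 fun y _ => eventually_approx_eq_skeleton hw y _
    have h' := (tendsto_add_atTop_nat 1).eventually
      (eventually_approx_eq_skeleton (e := e) hw v (k + 1))
    obtain ⟨n, hn, hn'⟩ := (h.and h').exists
    rw [← hn', ← localField_congr hn]
    rfl

/-- The spin of `v` is `s` from some ring on. -/
def Settles (a : I → ℕ → Spin) (v : I) (s : Spin) : Prop := ∀ᶠ k in atTop, a v k = s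

/-- The event that the Picard iteration for `v` settles at `s`. -/
def settleSet (nb : I → Finset I) (e : I → ℝ → ℤ) (v : I) (s : Spin) : Set (GlauberSample I) :=
  {w | ∀ᶠ k in atTop, ∀ᶠ n in atTop, approx nb e w n v k = s}

/-- Phrasing `settleSet` through the iterates keeps it measurable without assuming well-foundedness;
on the almost sure well-founded event it has the intended meaning. -/
lemma mem_settleSet_iff {nb : I → Finset I} {e : I → ℝ → ℤ} {w : GlauberSample I}
    (hw : WellFounded (SpinDep nb w)) (v : I) (s : Spin) :
    w ∈ settleSet nb e v s ↔ Settles (skeleton nb e w) v s := by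
  simp only [settleSet, Set.mem_ofPred_eq, eventually_approx_eq_iff hw, Settles]

/-- Pulling back samples along an embedding of sites. -/
def pullSample (f : J → I) (w : GlauberSample I) : GlauberSample J := fun j => w (f j)

/-- Restriction to a subset of the sites: the influence of neighbours outside the subset is absorbed
in the external field. -/
lemma IsSkeleton.pull {nb : I → Finset I} {e : I → ℝ → ℤ} {w : GlauberSample I}
    {a : I → ℕ → Spin} (ha : IsSkeleton nb e w a) (f : J → I) {nb' : J → Finset J}
    {e' : J → ℝ → ℤ}
    (h : ∀ j t, localField nb e w a (f j) t =
      ∑ y ∈ nb' j, (a (f y) (ringCount w (f y) t) : ℤ) + e' j t) :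
    IsSkeleton nb' e' (pullSample f w) (fun j => a (f j)) where
  zero v := ha.zero (f v)
  succ v k := by
    simp only [ha.succ, h]
    rfl

lemma wellFounded_spinDep_pull {nb : I → Finset I} {w : GlauberSample I}
    (hw : WellFounded (SpinDep nb w)) (f : J → I) {nb' : J → Finset J}
    (h : ∀ j, ∀ y ∈ nb' j, f y ∈ nb (f j)) : WellFounded (SpinDep nb' (pullSample f w)) := by
  refine Subrelation.wf ?_ (InvImage.wf (fun p : J × ℕ => (f p.1, p.2)) hw)
  rintro ⟨y, j⟩ ⟨v, k⟩ ⟨h1, m, h2, h3⟩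
  exact ⟨h _ _ h1, m, h2, h3⟩

/-- Here the image of `f` is closed under taking neighbours, so no field is created and the iterates
agree step by step, for every sample. -/
lemma approx_pull {nb : I → Finset I} {w : GlauberSample I} (f : J → I) {nb' : J → Finset J}
    (h : ∀ j (F : I → ℤ), ∑ y ∈ nb (f j), F y = ∑ y ∈ nb' j, F (f y)) (n : ℕ) (j : J) (k : ℕ) :
    approx nb (fun _ _ => 0) w n (f j) k =
      approx nb' (fun _ _ => 0) (pullSample f w) n j k := by
  induction n generalizing j k with
  | zero => rfl
  | succ n ih =>
    cases k with
    | zero => rfl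
    | succ k =>
      simp only [approx, localField, h, ih]
      rfl

/-- The global spin flip. -/
def flipSample (w : GlauberSample I) : GlauberSample I :=
  fun v => (-(w v).1, (w v).2.1, fun k => -(w v).2.2 k)

lemma approx_flip (nb : I → Finset I) (e : I → ℝ → ℤ) (w : GlauberSample I) (n : ℕ) (v : I)
    (k : ℕ) : approx nb (fun v t => -e v t) (flipSample w) n v k = -approx nb e w n v k := by
  induction n generalizing v k with
  | zero => rfl
  | succ n ih =>
    cases k with
    | zero => rfl
    | succ k =>
      simp only [approx]
      rw [← heatBath_neg]
      congr 1
      simp only [localField, ih, Units.val_neg, Finset.sum_neg_distrib, neg_add]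
      rfl

end Skeleton

/-! ### Evolutions and their embedded chains -/

section Evolution

variable {I : Type*}

/-- All waiting times are positive, every clock rings infinitely often but only finitely often in
bounded time, and different clocks never ring simultaneously. -/
structure RegularClocks (w : GlauberSample I) : Prop where
  wait_pos : ∀ v k, 0 < (w v).2.1 k
  tendsto : ∀ v, Tendsto (w.ringTime v) atTop atTop
  ne : ∀ u v, u ≠ v → ∀ j k, w.ringTime u j ≠ w.ringTime v k

lemma strictMono_ringTime {w : GlauberSample I} {v : I} (hw : ∀ k, 0 < (w v).2.1 k) :
    StrictMono (w.ringTime v) := by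
  refine strictMono_nat_of_lt_succ fun k => ?_
  rw [GlauberSample.ringTime, GlauberSample.ringTime, Finset.sum_range_succ _ (k + 1)]
  linarith [hw (k + 1)]

lemma RegularClocks.strictMono {w : GlauberSample I} (hw : RegularClocks w) (v : I) :
    StrictMono (w.ringTime v) := strictMono_ringTime (hw.wait_pos v)

lemma RegularClocks.pos {w : GlauberSample I} (hw : RegularClocks w) (v : I) (k : ℕ) :
    0 < w.ringTime v k :=
  Finset.sum_pos (fun i _ => hw.wait_pos v i) ⟨0, by simp⟩

lemma RegularClocks.pull {J : Type*} {w : GlauberSample I} (hw : RegularClocks w) {f : J → I}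
    (hf : Function.Injective f) : RegularClocks (pullSample f w) where
  wait_pos v k := hw.wait_pos (f v) k
  tendsto v := hw.tendsto (f v)
  ne u v h := hw.ne (f u) (f v) (hf.ne h)

/-- Ring times tend to infinity, so the infimum defining `ringCount` is attained and never takes the
default value of the empty set. -/
lemma RegularClocks.ringCount_le_iff {w : GlauberSample I} (hw : RegularClocks w) {v : I} {t : ℝ}
    {k : ℕ} : ringCount w v t ≤ k ↔ t < w.ringTime v k := by
  have hne : {k | t < w.ringTime v k}.Nonempty := ((hw.tendsto v).eventually_gt_atTop t).exists
  refine ⟨fun h => ?_, fun h => Nat.sInf_le h⟩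
  exact lt_of_lt_of_le (Nat.sInf_mem hne) ((hw.strictMono v).monotone h)

lemma RegularClocks.lt_ringCount_iff {w : GlauberSample I} (hw : RegularClocks w) {v : I} {t : ℝ}
    {k : ℕ} : k < ringCount w v t ↔ w.ringTime v k ≤ t := by
  rw [← not_le, hw.ringCount_le_iff, not_lt]

lemma RegularClocks.ringCount_ringTime {w : GlauberSample I} (hw : RegularClocks w) (v : I)
    (k : ℕ) : ringCount w v (w.ringTime v k) = k + 1 :=
  le_antisymm (hw.ringCount_le_iff.2 (hw.strictMono v k.lt_succ_self))
    (hw.lt_ringCount_iff.2 le_rfl)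

lemma RegularClocks.ringCount_mono {w : GlauberSample I} (hw : RegularClocks w) (v : I) :
    Monotone (ringCount w v) := fun _ _ h =>
  hw.ringCount_le_iff.2 (h.trans_lt (hw.ringCount_le_iff.1 le_rfl))

lemma RegularClocks.tendsto_ringCount {w : GlauberSample I} (hw : RegularClocks w) (v : I) :
    Tendsto (ringCount w v) atTop atTop :=
  tendsto_atTop_atTop_of_monotone (hw.ringCount_mono v) fun k =>
    ⟨w.ringTime v k, (hw.lt_ringCount_iff.2 le_rfl).le⟩

lemma RegularClocks.ringCount_zero {w : GlauberSample I} (hw : RegularClocks w) (v : I) :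
    ringCount w v 0 = 0 :=
  Nat.le_zero.1 (hw.ringCount_le_iff.2 (hw.pos v 0))

lemma RegularClocks.eventually_ringCount_eq {w : GlauberSample I} (hw : RegularClocks w) {v : I}
    {t : ℝ≥0} (ht : ∀ k, w.ringTime v k ≠ t) :
    ∀ᶠ s : ℝ≥0 in 𝓝[<] t, ringCount w v s = ringCount w v t := by
  have hlt : ∀ᶠ s : ℝ≥0 in 𝓝[<] t, s < t := self_mem_nhdsWithin
  rcases hn : ringCount w v t with _ | m
  · filter_upwards [hlt] with s hs
    exact Nat.le_zero.1 (hn ▸ hw.ringCount_mono v (NNReal.coe_le_coe.2 hs.le))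
  · have hm : w.ringTime v m < t :=
      lt_of_le_of_ne (hw.lt_ringCount_iff.1 (by omega)) (ht m)
    have hnear : ∀ᶠ s : ℝ≥0 in 𝓝[<] t, w.ringTime v m < s :=
      (NNReal.continuous_coe.continuousWithinAt.tendsto).eventually (lt_mem_nhds hm)
    filter_upwards [hlt, hnear] with s hs hs'
    refine le_antisymm (hn ▸ hw.ringCount_mono v (NNReal.coe_le_coe.2 hs.le)) ?_
    exact hw.lt_ringCount_iff.2 hs'.le

lemma RegularClocks.eventually_ringCount_eq_of_ring {w : GlauberSample I} (hw : RegularClocks w)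
    {v : I} {k : ℕ} {t : ℝ≥0} (ht : w.ringTime v k = t) :
    ∀ᶠ s : ℝ≥0 in 𝓝[<] t, ringCount w v s = k := by
  have hlt : ∀ᶠ s : ℝ≥0 in 𝓝[<] t, s < t := self_mem_nhdsWithin
  have hle : ∀ᶠ s : ℝ≥0 in 𝓝[<] t, ringCount w v s ≤ k := by
    filter_upwards [hlt] with s hs
    rw [hw.ringCount_le_iff, ht]
    exact NNReal.coe_lt_coe.2 hs
  rcases k with _ | m
  · filter_upwards [hle] with s hs using Nat.le_zero.1 hs
  · have hm : w.ringTime v m < t := ht ▸ hw.strictMono v m.lt_succ_self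
    have hnear : ∀ᶠ s : ℝ≥0 in 𝓝[<] t, w.ringTime v m < s :=
      (NNReal.continuous_coe.continuousWithinAt.tendsto).eventually (lt_mem_nhds hm)
    filter_upwards [hle, hnear] with s hs hs'
    exact le_antisymm hs (hw.lt_ringCount_iff.2 hs'.le)

variable {V : Type*} (G : SimpleGraph V) [G.LocallyFinite]

/-- The energy change is twice the spin times the field, so a flip lowers the energy exactly when
the spin opposes the field; in either strict case the result is the sign of the field. -/
lemma updatedSpin_eq_heatBath (σ : V → Spin) (v : V) (b : Spin) :
    updatedSpin G σ v b = heatBath (∑ y ∈ G.neighborFinset v, (σ y : ℤ)) b := by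
  unfold updatedSpin heatBath energyChange
  rw [← Finset.mul_sum]
  generalize ∑ y ∈ G.neighborFinset v, (σ y : ℤ) = h
  rcases Int.units_eq_one_or (σ v) with hv | hv <;> rw [hv] <;>
    split_ifs <;> first | rfl | (simp at *; omega)

/-- The neighbourhoods of the Glauber dynamics on `G`. -/
def nbrs : V → Finset V := fun v => G.neighborFinset v

variable {G}

lemma localField_nbrs {w : GlauberSample V} (a : V → ℕ → Spin) (v : V) (t : ℝ) :
    localField (nbrs G) (fun _ _ => 0) w a v t =
      ∑ y ∈ G.neighborFinset v, (a y (ringCount w y t) : ℤ) := by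
  simp [localField, nbrs]

/-- Neighbours do not ring together with `v`, so the configuration they show just before the ring is
the one at the ring time. This is why the chain may evaluate `localField` at the ring time itself.
-/
lemma RegularClocks.eventually_neighbors {w : GlauberSample V} (hw : RegularClocks w) {v : V}
    {k : ℕ} {t : ℝ≥0} (ht : w.ringTime v k = t) :
    ∀ᶠ s : ℝ≥0 in 𝓝[<] t, ∀ y ∈ G.neighborFinset v, ringCount w y s = ringCount w y t := by
  refine (eventually_all_finset _).2 fun y hy => hw.eventually_ringCount_eq fun j hj => ?_
  have hne : y ≠ v := ((G.mem_neighborFinset v y).1 hy).ne'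
  exact hw.ne y v hne j k (hj.trans ht.symm)

lemma IsSkeleton.isGlauberEvolution {w : GlauberSample V} (hw : RegularClocks w)
    {a : V → ℕ → Spin} (ha : IsSkeleton (nbrs G) (fun _ _ => 0) w a) :
    IsGlauberEvolution G w fun t v => a v (ringCount w v t) where
  start v := by
    simp only [NNReal.coe_zero, hw.ringCount_zero, ha.zero]
  const v s t hst h := by
    have : ringCount w v t = ringCount w v s := by
      refine eq_of_forall_ge_iff fun k => ?_
      rw [hw.ringCount_le_iff, hw.ringCount_le_iff]
      refine ⟨fun hk => (NNReal.coe_le_coe.2 hst).trans_lt hk, fun hk => ?_⟩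
      by_contra hk'
      exact h k ⟨hk, not_lt.1 hk'⟩
    simp only [this]
  ring v k t ht := by
    filter_upwards [hw.eventually_neighbors (G := G) ht] with s hs
    rw [updatedSpin_eq_heatBath, ← ht, hw.ringCount_ringTime, ha.succ, localField_nbrs]
    congr 1
    refine Finset.sum_congr rfl fun y hy => ?_
    rw [hs y hy, ht]

/-- The embedded chain of an evolution. -/
noncomputable def chainOf (w : GlauberSample V) (σ : ℝ≥0 → V → Spin) (v : V) : ℕ → Spin
  | 0 => σ 0 v
  | k + 1 => σ (w.ringTime v k).toNNReal v

lemma IsGlauberEvolution.eq_chainOf {w : GlauberSample V} (hw : RegularClocks w)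
    {σ : ℝ≥0 → V → Spin} (hσ : IsGlauberEvolution G w σ) (t : ℝ≥0) (v : V) :
    σ t v = chainOf w σ v (ringCount w v t) := by
  rcases hn : ringCount w v t with _ | m
  · refine hσ.const v 0 t zero_le fun k hk => ?_
    have := hw.lt_ringCount_iff.2 hk.2
    omega
  · have hm : w.ringTime v m ≤ t := hw.lt_ringCount_iff.1 (by omega)
    refine hσ.const v _ t ((Real.toNNReal_le_iff_le_coe).2 hm) fun k hk => ?_
    rw [Real.coe_toNNReal _ (hw.pos v m).le] at hk
    have h1 := hw.lt_ringCount_iff.2 hk.2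
    have h2 := (hw.strictMono v).lt_iff_lt.1 hk.1
    omega

lemma IsGlauberEvolution.isSkeleton_chainOf {w : GlauberSample V} (hw : RegularClocks w)
    {σ : ℝ≥0 → V → Spin} (hσ : IsGlauberEvolution G w σ) :
    IsSkeleton (nbrs G) (fun _ _ => 0) w (chainOf w σ) where
  zero v := hσ.start v
  succ v k := by
    have ht : w.ringTime v k = (w.ringTime v k).toNNReal :=
      (Real.coe_toNNReal _ (hw.pos v k).le).symm
    have hpos : (0 : ℝ≥0) < (w.ringTime v k).toNNReal := Real.toNNReal_pos.2 (hw.pos v k)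
    have : (𝓝[<] (w.ringTime v k).toNNReal).NeBot := nhdsLT_neBot_of_exists_lt ⟨0, hpos⟩
    obtain ⟨s, hs, hs'⟩ :=
      ((hσ.ring v k _ ht).and (hw.eventually_neighbors (G := G) ht)).exists
    change σ _ v = _
    rw [hs, updatedSpin_eq_heatBath, localField_nbrs]
    congr 1
    refine Finset.sum_congr rfl fun y hy => ?_
    rw [hσ.eq_chainOf hw s y, hs' y hy, ← ht]

/-- Sampling a convergent evolution at ring times gives a settled chain. Conversely, a chain that
does not settle changes at infinitely many rings, and each such ring is a distinct flip time. -/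
lemma not_freezes_of_not_settles {w : GlauberSample V} (hw : RegularClocks w)
    {a : V → ℕ → Spin} (h : ¬ ∀ v, ∃ s, Settles a v s) :
    (¬ Freezes fun (t : ℝ≥0) v => a v (ringCount w v t)) ∧
      ∃ v, (flipTimes (fun (t : ℝ≥0) v => a v (ringCount w v t)) v).Infinite := by
  constructor
  · rintro ⟨l, hl⟩
    refine h fun v => ⟨l v, ?_⟩
    obtain ⟨T, hT⟩ := eventually_atTop.1 (hl v)
    obtain ⟨K, hK⟩ := eventually_atTop.1 (tendsto_atTop.1 (hw.tendsto v) T)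
    refine eventually_atTop.2 ⟨K + 1, fun k hk => ?_⟩
    obtain ⟨m, rfl⟩ : ∃ m, k = m + 1 := ⟨k - 1, by omega⟩
    have ht : ((w.ringTime v m).toNNReal : ℝ) = w.ringTime v m :=
      Real.coe_toNNReal _ (hw.pos v m).le
    have := hT _ (NNReal.le_toNNReal_of_coe_le (hK m (by omega)))
    simpa only [ht, hw.ringCount_ringTime] using this
  · push Not at h
    obtain ⟨v, hv⟩ := h
    refine ⟨v, ?_⟩
    have hflip : ∃ᶠ k in atTop, a v (k + 1) ≠ a v k := by
      intro hc
      obtain ⟨K, hK⟩ := eventually_atTop.1 hc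
      refine hv (a v K) (eventually_atTop.2 ⟨K, fun k hk => ?_⟩)
      induction k, hk using Nat.le_induction with
      | base => rfl
      | succ k hk ih => rw [← ih]; exact not_not.1 (hK k hk)
    have hinf := Nat.frequently_atTop_iff_infinite.1 hflip
    refine (hinf.image (f := fun k => (w.ringTime v k).toNNReal) ?_).mono ?_
    · intro j _ k _ hjk
      exact (hw.strictMono v).injective
        ((Real.toNNReal_eq_toNNReal_iff (hw.pos v j).le (hw.pos v k).le).1 hjk)
    · rintro _ ⟨k, hk, rfl⟩
      have ht : w.ringTime v k = (w.ringTime v k).toNNReal :=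
        (Real.coe_toNNReal _ (hw.pos v k).le).symm
      have hpos : (0 : ℝ≥0) < (w.ringTime v k).toNNReal := Real.toNNReal_pos.2 (hw.pos v k)
      have : (𝓝[<] (w.ringTime v k).toNNReal).NeBot := nhdsLT_neBot_of_exists_lt ⟨0, hpos⟩
      refine Eventually.frequently ?_
      filter_upwards [hw.eventually_ringCount_eq_of_ring ht] with s hs
      rw [hs, ← ht, hw.ringCount_ringTime]
      exact Ne.symm hk

/-- For regular clocks and well-founded dependencies there is exactly one evolution; it does not
freeze if some spin of the embedded chain does not settle. -/
lemma exists_unique_evolution {w : GlauberSample V} (hw : RegularClocks w)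
    (hwf : WellFounded (SpinDep (nbrs G) w))
    (h : ¬ ∀ v, ∃ s, Settles (skeleton (nbrs G) (fun _ _ => 0) w) v s) :
    ∃ σ : ℝ≥0 → V → Spin, IsGlauberEvolution G w σ ∧
      (∀ σ' : ℝ≥0 → V → Spin, IsGlauberEvolution G w σ' → σ' = σ) ∧
      ¬ Freezes σ ∧ ∃ v : V, (flipTimes σ v).Infinite := by
  have hs := isSkeleton_skeleton (e := fun _ _ => 0) hwf
  refine ⟨_, hs.isGlauberEvolution hw, fun σ' hσ' => ?_, not_freezes_of_not_settles hw h⟩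
  funext t v
  rw [hσ'.eq_chainOf hw, (hσ'.isSkeleton_chainOf hw).unique hwf hs]

end Evolution

/-! ### The law of a single Poisson clock -/

section Clock

open scoped ENNReal

lemma expMeasure_one_le_volume : expMeasure 1 ≤ volume := by
  rw [expMeasure, gammaMeasure]
  refine (withDensity_mono (g := 1) (.of_forall fun x => ?_)).trans_eq withDensity_one
  rw [gammaPDF, Pi.one_apply, ENNReal.ofReal_le_one, gammaPDFReal]
  split_ifs with h
  · simp [h]
  · exact zero_le_one

lemma expMeasure_one_Iic_zero : expMeasure 1 (Set.Iic 0) = 0 := by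
  have h := cdf_expMeasure_eq one_pos 0
  simp only [le_refl, if_true, mul_zero, neg_zero, Real.exp_zero, sub_self] at h
  rw [cdf_eq_real, measureReal_eq_zero_iff] at h
  exact h

lemma expMeasure_one_Iic_lt_one (b : ℝ) : expMeasure 1 (Set.Iic b) < 1 := by
  have h : (expMeasure 1).real (Set.Iic b) < 1 := by
    rw [← cdf_eq_real, cdf_expMeasure_eq one_pos]
    split_ifs with h
    · linarith [Real.exp_pos (-(1 * b))]
    · exact one_pos
  rw [measureReal_def] at h
  rw [← ENNReal.toReal_lt_toReal (measure_ne_top _ _) ENNReal.one_ne_top]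
  simpa using h

/-- The law of the waiting times of one clock. -/
noncomputable def clockLaw : Measure (ℕ → ℝ) := Measure.infinitePi fun _ : ℕ => expMeasure 1

instance clockLaw_isProbabilityMeasure : IsProbabilityMeasure clockLaw := by
  unfold clockLaw; infer_instance

lemma measurePreserving_wait (k : ℕ) :
    MeasurePreserving (fun x : ℕ → ℝ => x k) clockLaw (expMeasure 1) :=
  measurePreserving_eval_infinitePi (fun _ : ℕ => expMeasure 1) k

lemma ae_wait_pos : ∀ᵐ x ∂clockLaw, ∀ k, 0 < x k := by
  refine ae_all_iff.2 fun k => ?_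
  refine (measurePreserving_wait k).quasiMeasurePreserving.ae (p := fun y => 0 < y) ?_
  rw [ae_iff]
  simp only [not_lt]
  exact expMeasure_one_Iic_zero

/-- Waiting times are positive, so a sum bounded by `b` forces every term below `b`; these events
are independent. -/
lemma clockLaw_sum_le (k : ℕ) (b : ℝ) :
    clockLaw {x | ∑ i ∈ Finset.range k, x i ≤ b} ≤ expMeasure 1 (Set.Iic b) ^ k := by
  have h : clockLaw (Set.pi (Finset.range k) fun _ => Set.Iic b) =
      expMeasure 1 (Set.Iic b) ^ k := by
    rw [clockLaw, Measure.infinitePi_pi _ fun _ _ => measurableSet_Iic]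
    simp
  rw [← h]
  refine measure_mono_ae ?_
  filter_upwards [ae_wait_pos] with x hx hsum i hi
  exact (Finset.single_le_sum (f := x) (fun j _ => (hx j).le) hi).trans hsum

/-- Given the first `k` waiting times, the next one must fall in an interval of length `b - a`, and
its density is at most 1. If their sum already exceeds `b`, it would have to be negative. -/
lemma clockLaw_ring_Ioc_le (k : ℕ) (a b : ℝ) :
    clockLaw {x | ∑ i ∈ Finset.range (k + 1), x i ∈ Set.Ioc a b} ≤
      ENNReal.ofReal (b - a) * clockLaw {x | ∑ i ∈ Finset.range k, x i ≤ b} := by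
  have hind : IndepFun (fun x : ℕ → ℝ => ∑ i ∈ Finset.range k, x i) (fun x => x k) clockLaw := by
    have := (iIndepFun_infinitePi (P := fun _ : ℕ => expMeasure 1) (X := fun _ x => x)
      (fun _ => measurable_id)).indepFun_finsetSum_of_notMem (fun i => measurable_pi_apply i)
      (Finset.notMem_range_self (n := k))
    convert this using 1
    · ext x
      simp
    · rfl
  have hm : Measurable fun x : ℕ → ℝ => ∑ i ∈ Finset.range k, x i := by fun_prop
  have hmap := (indepFun_iff_map_prod_eq_prod_map_map hm.aemeasurable
    (measurable_pi_apply k).aemeasurable).1 hind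
  rw [(measurePreserving_wait k).map_eq] at hmap
  have hset : MeasurableSet {p : ℝ × ℝ | p.1 + p.2 ∈ Set.Ioc a b} :=
    (measurable_fst.add measurable_snd) measurableSet_Ioc
  have h1 : clockLaw {x | ∑ i ∈ Finset.range (k + 1), x i ∈ Set.Ioc a b} =
      (clockLaw.map fun x : ℕ → ℝ => (∑ i ∈ Finset.range k, x i, x k))
        {p : ℝ × ℝ | p.1 + p.2 ∈ Set.Ioc a b} := by
    rw [Measure.map_apply (hm.prodMk (measurable_pi_apply k)) hset]
    simp only [Finset.sum_range_succ]
    rfl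
  have h2 : clockLaw {x | ∑ i ∈ Finset.range k, x i ≤ b} =
      (clockLaw.map fun x : ℕ → ℝ => ∑ i ∈ Finset.range k, x i) (Set.Iic b) := by
    rw [Measure.map_apply hm measurableSet_Iic]
    rfl
  rw [h1, h2, hmap, Measure.prod_apply hset, ← setLIntegral_const,
    ← lintegral_indicator measurableSet_Iic]
  refine lintegral_mono fun s => ?_
  have hpre : Prod.mk s ⁻¹' {p : ℝ × ℝ | p.1 + p.2 ∈ Set.Ioc a b} = Set.Ioc (a - s) (b - s) := by
    ext y
    simp [sub_lt_iff_lt_add', le_sub_iff_add_le']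
  simp only [hpre]
  by_cases hs : s ≤ b
  · rw [Set.indicator_of_mem (Set.mem_Iic.2 hs)]
    refine (expMeasure_one_le_volume _).trans_eq ?_
    rw [Real.volume_Ioc, sub_sub_sub_cancel_right]
  · have hsub : Set.Ioc (a - s) (b - s) ⊆ Set.Iic 0 := fun y hy =>
      hy.2.trans (by linarith [not_le.1 hs])
    rw [measure_mono_null hsub expMeasure_one_Iic_zero]
    exact zero_le

/-- A bound for the intensity of the rings up to time `b`. -/
noncomputable def ringBound (b : ℝ) : ℝ≥0∞ := ∑' k : ℕ, expMeasure 1 (Set.Iic b) ^ k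

lemma ringBound_ne_top (b : ℝ) : ringBound b ≠ ∞ := by
  rw [ringBound, ENNReal.tsum_geometric, Ne, ENNReal.inv_eq_top, tsub_eq_zero_iff_le, not_le]
  exact expMeasure_one_Iic_lt_one b

/-- The time of ring number `k` of a clock with waiting times `x`. -/
noncomputable def clockRing (x : ℕ → ℝ) (k : ℕ) : ℝ := ∑ i ∈ Finset.range (k + 1), x i

lemma measurable_clockRing (k : ℕ) : Measurable fun x => clockRing x k := by
  unfold clockRing; fun_prop

lemma clockLaw_exists_ring_le (a b : ℝ) :
    clockLaw {x | ∃ k, clockRing x k ∈ Set.Ioc a b} ≤ ENNReal.ofReal (b - a) * ringBound b := by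
  rw [Set.ofPred_exists, ringBound, ← ENNReal.tsum_mul_left]
  refine (measure_iUnion_le _).trans (ENNReal.tsum_le_tsum fun k => ?_)
  exact (clockLaw_ring_Ioc_le k a b).trans (by gcongr; exact clockLaw_sum_le k b)

/-- Borel–Cantelli, with the geometric series `ringBound`. -/
lemma ae_tendsto_clockRing : ∀ᵐ x ∂clockLaw, Tendsto (clockRing x) atTop atTop := by
  have h : ∀ᵐ x ∂clockLaw, ∀ b : ℕ, ∀ᶠ k in atTop, (b : ℝ) < clockRing x k := by
    refine ae_all_iff.2 fun b => ?_
    have hs : ∑' k, clockLaw {x | clockRing x k ≤ b} ≠ ∞ := by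
      refine ne_top_of_le_ne_top (ringBound_ne_top b) ?_
      refine ENNReal.tsum_le_tsum fun k => (clockLaw_sum_le (k + 1) b).trans ?_
      exact pow_le_pow_of_le_one zero_le prob_le_one k.le_succ
    filter_upwards [ae_eventually_notMem hs] with x hx
    filter_upwards [hx] with k hk
    exact not_le.1 hk
  filter_upwards [h] with x hx
  refine tendsto_atTop.2 fun b => ?_
  obtain ⟨n, hn⟩ := exists_nat_ge b
  filter_upwards [hx n] with k hk
  exact hn.trans hk.le

lemma clockLaw_clockRing_eq (k : ℕ) (c : ℝ) : clockLaw {x | clockRing x k = c} = 0 := by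
  refine le_antisymm (ENNReal.le_of_forall_pos_le_add fun ε hε _ => ?_) zero_le
  rw [zero_add]
  calc clockLaw {x | clockRing x k = c}
      ≤ clockLaw {x | ∑ i ∈ Finset.range (k + 1), x i ∈ Set.Ioc (c - ε) c} := by
        refine measure_mono fun x hx => ?_
        change clockRing x k ∈ Set.Ioc (c - (ε : ℝ)) c
        rw [Set.mem_ofPred_eq] at hx
        rw [hx]
        exact ⟨sub_lt_self _ (NNReal.coe_pos.2 hε), le_rfl⟩
    _ ≤ ENNReal.ofReal (c - (c - ε)) * 1 :=
        (clockLaw_ring_Ioc_le k _ _).trans (by gcongr; exact prob_le_one)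
    _ = ε := by rw [sub_sub_cancel, mul_one, ENNReal.ofReal_coe_nnreal]

end Clock

/-! ### Measurability of the Picard iteration -/

section Measurability

variable {I J Ω : Type*}

lemma nat_sInf_eq_iff (S : Set ℕ) (n : ℕ) :
    sInf S = n ↔ (n ∈ S ∧ ∀ m < n, m ∉ S) ∨ (n = 0 ∧ ∀ m, m ∉ S) := by
  constructor
  · rintro rfl
    rcases S.eq_empty_or_nonempty with rfl | hS
    · exact .inr ⟨Nat.sInf_empty, fun m => Set.notMem_empty m⟩
    · exact .inl ⟨Nat.sInf_mem hS, fun m hm => Nat.notMem_of_lt_sInf hm⟩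
  · rintro (⟨h1, h2⟩ | ⟨rfl, h⟩)
    · exact le_antisymm (Nat.sInf_le h1) (le_csInf ⟨n, h1⟩ fun m hm => not_lt.1 fun hlt => h2 m hlt hm)
    · rw [Set.eq_empty_of_forall_notMem h, Nat.sInf_empty]

variable [MeasurableSpace Ω]

lemma measurable_ringTime_comp {W : Ω → GlauberSample I} {v : I}
    (hv : Measurable fun ω => W ω v) (k : ℕ) : Measurable fun ω => (W ω).ringTime v k := by
  have : ∀ i, Measurable fun ω => (W ω v).2.1 i := fun i =>
    (measurable_pi_apply i).comp (measurable_fst.comp (measurable_snd.comp hv))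
  exact Finset.measurable_sum _ fun i _ => this i

lemma measurable_ringCount_comp {W : Ω → GlauberSample I} {v : I}
    (hv : Measurable fun ω => W ω v) {f : Ω → ℝ} (hf : Measurable f) :
    Measurable fun ω => ringCount (W ω) v (f ω) := by
  have hk : ∀ k, MeasurableSet {ω | f ω < (W ω).ringTime v k} := fun k =>
    measurableSet_lt hf (measurable_ringTime_comp hv k)
  refine measurable_to_countable' fun n => ?_
  have : (fun ω => ringCount (W ω) v (f ω)) ⁻¹' {n} =
      ({ω | f ω < (W ω).ringTime v n} ∩ ⋂ m, ⋂ (_ : m < n), {ω | f ω < (W ω).ringTime v m}ᶜ) ∪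
        ({ω | n = 0} ∩ ⋂ m, {ω | f ω < (W ω).ringTime v m}ᶜ) := by
    ext ω
    simp [ringCount, nat_sInf_eq_iff]
  rw [this]
  exact ((hk n).inter (.iInter fun m => .iInter fun _ => (hk m).compl)).union
    ((MeasurableSet.const _).inter (.iInter fun m => (hk m).compl))

lemma measurable_heatBath_comp {h : Ω → ℤ} {b : Ω → Spin} (hh : Measurable h) (hb : Measurable b) :
    Measurable fun ω => heatBath (h ω) (b ω) := by
  unfold heatBath
  refine Measurable.ite (hh (measurableSet_Ioi (a := 0))) measurable_const ?_
  exact Measurable.ite (hh (measurableSet_Iio (a := 0))) measurable_const hb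

lemma measurable_spin_coe : Measurable fun s : Spin => (s : ℤ) := measurable_of_countable _

/-- The sites on which `approx nb e w n v` depends. -/
def depBall (nb : I → Finset I) : ℕ → I → Set I
  | 0, v => {v}
  | n + 1, v => insert v (⋃ y ∈ nb v, depBall nb n y)

lemma mem_depBall_self (nb : I → Finset I) (n : ℕ) (v : I) : v ∈ depBall nb n v := by
  cases n <;> simp [depBall]

lemma finite_depBall (nb : I → Finset I) (n : ℕ) (v : I) : (depBall nb n v).Finite := by
  induction n generalizing v with
  | zero => exact Set.finite_singleton v
  | succ n ih => exact ((nb v).finite_toSet.biUnion fun y _ => ih y).insert v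

/-- Measurability is required only of the coordinates in the dependency ball, so the lemma serves
both the full σ-algebra and `siteAlg` of that ball. -/
lemma measurable_approx_comp (nb : I → Finset I) {e : I → ℝ → ℤ} (he : ∀ v, Measurable (e v))
    {W : Ω → GlauberSample I} (n : ℕ) (v : I) (k : ℕ)
    (hW : ∀ u ∈ depBall nb n v, Measurable fun ω => W ω u) :
    Measurable fun ω => approx nb e (W ω) n v k := by
  have hinit : ∀ u, (Measurable fun ω => W ω u) → Measurable fun ω => (W ω).init u :=
    fun u hu => measurable_fst.comp hu
  induction n generalizing v k with
  | zero => exact hinit v (hW v rfl)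
  | succ n ih =>
    have hv := hW v (mem_depBall_self nb _ v)
    cases k with
    | zero => exact hinit v hv
    | succ k =>
      have hy : ∀ y ∈ nb v, ∀ u ∈ depBall nb n y, Measurable fun ω => W ω u :=
        fun y hy u hu => hW u (Set.mem_insert_of_mem _ (Set.mem_biUnion hy hu))
      have ht := measurable_ringTime_comp hv k
      simp only [approx]
      refine measurable_heatBath_comp ?_
        ((measurable_pi_apply k).comp (measurable_snd.comp (measurable_snd.comp hv)))
      unfold localField
      refine (Finset.measurable_sum _ fun y hyv => ?_).add ((he v).comp ht)
      refine measurable_spin_coe.comp ?_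
      have hc : Measurable fun ω => ringCount (W ω) y ((W ω).ringTime v k) :=
        measurable_ringCount_comp (hy y hyv y (mem_depBall_self nb n y)) ht
      -- The neighbour's spin is evaluated at a random ring index; joint measurability holds because
      -- there are countably many indices.
      have hu : Measurable fun p : ℕ × Ω => approx nb e (W p.2) n y p.1 :=
        measurable_from_prod_countable_right fun j => ih y j (hy y hyv)
      exact hu.comp (hc.prodMk measurable_id)

lemma measurableSet_settleSet (nb : I → Finset I) {e : I → ℝ → ℤ} (he : ∀ v, Measurable (e v))
    (v : I) (s : Spin) : MeasurableSet (settleSet nb e v s) := by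
  have h : ∀ n k, MeasurableSet {w | approx nb e w n v k = s} := fun n k =>
    (measurable_approx_comp nb he (W := id) n v k fun u _ => measurable_pi_apply u)
      (measurableSet_singleton s)
  simp only [settleSet, eventually_atTop, Set.ofPred_exists, Set.ofPred_forall]
  exact .iUnion fun K => .iInter fun k => .iInter fun _ => .iUnion fun N => .iInter fun n =>
    .iInter fun _ => h n k

end Measurability

/-! ### The joint law -/

section Law

variable {I J V : Type*}

open scoped ENNReal

/-- The law of the randomness attached to one site. -/
noncomputable def siteLaw : Measure (Spin × (ℕ → ℝ) × (ℕ → Spin)) :=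
  fairSpin.prod (clockLaw.prod (Measure.infinitePi fun _ : ℕ => fairSpin))

instance siteLaw_isProbabilityMeasure : IsProbabilityMeasure siteLaw := by
  unfold siteLaw; infer_instance

instance glauberLaw_isProbabilityMeasure : IsProbabilityMeasure (glauberLaw V) := by
  unfold glauberLaw; infer_instance

lemma measurePreserving_site (v : V) :
    MeasurePreserving (fun w : GlauberSample V => w v) (glauberLaw V) siteLaw :=
  measurePreserving_eval_infinitePi (fun _ : V => siteLaw) v

lemma measurePreserving_clock (v : V) :
    MeasurePreserving (fun w : GlauberSample V => (w v).2.1) (glauberLaw V) clockLaw :=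
  measurePreserving_fst.comp (measurePreserving_snd.comp (measurePreserving_site v))

lemma measurePreserving_coins (v : V) :
    MeasurePreserving (fun w : GlauberSample V => (w v).2.2) (glauberLaw V)
      (Measure.infinitePi fun _ : ℕ => fairSpin) :=
  measurePreserving_snd.comp (measurePreserving_snd.comp (measurePreserving_site v))

lemma measurable_pullSample (f : J → I) : Measurable (pullSample f) :=
  measurable_pi_lambda _ fun _ => measurable_pi_apply _

lemma measurePreserving_pullSample {f : J → I} (hf : Function.Injective f) :
    MeasurePreserving (pullSample f) (glauberLaw I) (glauberLaw J) :=
  ⟨measurable_pullSample f,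
    Measure.map_infinitePi_infinitePi_of_inj (P := fun _ : I => siteLaw) hf⟩

lemma fairSpin_singleton (s : Spin) : fairSpin {s} = 2⁻¹ := by
  rw [fairSpin, PMF.toMeasure_apply_singleton _ _ (measurableSet_singleton s)]
  simp

lemma measurePreserving_neg_fairSpin : MeasurePreserving (fun s : Spin => -s) fairSpin fairSpin := by
  refine ⟨measurable_of_countable _, Measure.ext_of_singleton fun s => ?_⟩
  rw [Measure.map_apply (measurable_of_countable _) (measurableSet_singleton s)]
  have : (fun s : Spin => -s) ⁻¹' {s} = {-s} := by
    ext t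
    simp
  rw [this, fairSpin_singleton, fairSpin_singleton]

lemma measurePreserving_flipSample :
    MeasurePreserving (flipSample (I := I)) (glauberLaw I) (glauberLaw I) := by
  have hc : MeasurePreserving (fun (c : ℕ → Spin) k => -c k)
      (Measure.infinitePi fun _ : ℕ => fairSpin) (Measure.infinitePi fun _ : ℕ => fairSpin) := by
    refine ⟨measurable_pi_lambda _ fun k =>
      measurePreserving_neg_fairSpin.measurable.comp (measurable_pi_apply k), ?_⟩
    rw [Measure.infinitePi_map_pi _ fun _ => measurePreserving_neg_fairSpin.measurable]
    simp only [measurePreserving_neg_fairSpin.map_eq]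
  have hs : MeasurePreserving (fun x : Spin × (ℕ → ℝ) × (ℕ → Spin) =>
      (-x.1, x.2.1, fun k => -x.2.2 k)) siteLaw siteLaw :=
    measurePreserving_neg_fairSpin.prod ((MeasurePreserving.id clockLaw).prod hc)
  refine ⟨measurable_pi_lambda _ fun v => hs.measurable.comp (measurable_pi_apply v), ?_⟩
  change (Measure.infinitePi fun _ : I => siteLaw).map _ = Measure.infinitePi fun _ : I => siteLaw
  have := Measure.infinitePi_map_pi (fun _ : I => siteLaw) fun _ : I => hs.measurable
  simp only [hs.map_eq] at this
  exact this

/-- The σ-algebra generated by the randomness attached to the sites in `S`. -/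
@[reducible] def siteAlg (S : Set I) : MeasurableSpace (GlauberSample I) :=
  ⨆ v ∈ S, MeasurableSpace.comap (fun w : GlauberSample I => w v) inferInstance

lemma siteAlg_mono {S T : Set I} (h : S ⊆ T) : siteAlg S ≤ siteAlg T :=
  biSup_mono h

lemma siteAlg_le (S : Set I) : siteAlg S ≤ MeasurableSpace.pi :=
  iSup₂_le fun v _ => (measurable_pi_apply v).comap_le

lemma measurable_site {S : Set I} {v : I} (hv : v ∈ S) :
    Measurable[siteAlg S] fun w : GlauberSample I => w v :=
  Measurable.mono (comap_measurable _) (le_biSup (fun v => MeasurableSpace.comap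
    (fun w : GlauberSample I => w v) inferInstance) hv) le_rfl

lemma measurable_pullSample_siteAlg (f : J → I) {S : Set I} (hS : ∀ j, f j ∈ S) :
    Measurable[siteAlg S] (pullSample f : GlauberSample I → GlauberSample J) := by
  refine @measurable_pi_lambda _ _ _ (siteAlg S) _ _ fun j => measurable_site (hS j)

lemma indep_siteAlg {S T : Set I} (h : Disjoint S T) :
    Indep (siteAlg S) (siteAlg T) (glauberLaw I) := by
  refine indep_iSup_of_disjoint (fun v => (measurable_pi_apply v).comap_le) ?_ h
  exact iIndepFun_infinitePi (P := fun _ : I => siteLaw) (X := fun _ x => x) fun _ => measurable_id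

lemma glauberLaw_inter {S T : Set I} (h : Disjoint S T) {A B : Set (GlauberSample I)}
    (hA : MeasurableSet[siteAlg S] A) (hB : MeasurableSet[siteAlg T] B) :
    glauberLaw I (A ∩ B) = glauberLaw I A * glauberLaw I B :=
  (Indep_iff _ _ _).1 (indep_siteAlg h) A B hA hB

lemma measurableSet_biInter_siteAlg {ι : Type*} (s : Finset ι) (S : ι → Set I)
    (A : ι → Set (GlauberSample I)) (hA : ∀ i, MeasurableSet[siteAlg (S i)] (A i)) :
    MeasurableSet[siteAlg (⋃ i ∈ s, S i)] (⋂ i ∈ s, A i) :=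
  Finset.measurableSet_biInter (m := siteAlg (⋃ i ∈ s, S i)) s fun i hi =>
    siteAlg_mono (Set.subset_biUnion_of_mem (u := S) hi) _ (hA i)

lemma glauberLaw_biInter {ι : Type*} (s : Finset ι) (S : ι → Set I)
    (hS : Pairwise fun i j => Disjoint (S i) (S j)) (A : ι → Set (GlauberSample I))
    (hA : ∀ i, MeasurableSet[siteAlg (S i)] (A i)) :
    glauberLaw I (⋂ i ∈ s, A i) = ∏ i ∈ s, glauberLaw I (A i) := by
  classical
  induction s using Finset.induction_on with
  | empty => simp
  | insert i s hi ih =>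
    rw [Finset.set_biInter_insert, Finset.prod_insert hi, ← ih]
    refine glauberLaw_inter ?_ (hA i) (measurableSet_biInter_siteAlg s S A hA)
    refine Set.disjoint_iUnion₂_right.2 fun j hj => hS ?_
    rintro rfl
    exact hi hj

variable [Countable V]

lemma ae_regularClocks : ∀ᵐ w ∂(glauberLaw V), RegularClocks w := by
  have h1 : ∀ᵐ w ∂(glauberLaw V), ∀ v k, 0 < (w v).2.1 k := ae_all_iff.2 fun v =>
    (measurePreserving_clock v).quasiMeasurePreserving.ae ae_wait_pos
  have h2 : ∀ᵐ w ∂(glauberLaw V), ∀ v, Tendsto (w.ringTime v) atTop atTop :=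
    ae_all_iff.2 fun v =>
      (measurePreserving_clock v).quasiMeasurePreserving.ae ae_tendsto_clockRing
  have h3 : ∀ᵐ w ∂(glauberLaw V), ∀ u v, u ≠ v → ∀ j k, w.ringTime u j ≠ w.ringTime v k := by
    refine ae_all_iff.2 fun u => ae_all_iff.2 fun v => Filter.eventually_imp_distrib_left.2 fun huv =>
      ae_all_iff.2 fun j => ae_all_iff.2 fun k => ?_
    have hmap : (glauberLaw V).map (fun w => (w u, w v)) = siteLaw.prod siteLaw :=
      Measure.infinitePi_map_eval_prod (P := fun _ : V => siteLaw) huv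
    have hp : MeasurePreserving (fun w : GlauberSample V => (w u, w v)) (glauberLaw V)
        (siteLaw.prod siteLaw) :=
      ⟨(measurable_pi_apply u).prodMk (measurable_pi_apply v), hmap⟩
    have hc : MeasurePreserving (fun x : Spin × (ℕ → ℝ) × (ℕ → Spin) => x.2.1) siteLaw clockLaw :=
      measurePreserving_fst.comp measurePreserving_snd
    refine ((hc.prod hc).comp hp).quasiMeasurePreserving.ae
      (p := fun x => clockRing x.1 j ≠ clockRing x.2 k) ?_
    have hset : MeasurableSet {x : (ℕ → ℝ) × (ℕ → ℝ) | clockRing x.1 j ≠ clockRing x.2 k} :=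
      (measurableSet_eq_fun ((measurable_clockRing j).comp measurable_fst)
        ((measurable_clockRing k).comp measurable_snd)).compl
    -- With the first clock fixed, the independent second clock hits a prescribed time with
    -- probability zero.
    refine (Measure.ae_prod_iff_ae_ae hset).2 (.of_forall fun x => ?_)
    rw [ae_iff]
    simp only [ne_eq, not_not]
    convert clockLaw_clockRing_eq k (clockRing x j) using 3
    ext y
    exact eq_comm
  filter_upwards [h1, h2, h3] with w w1 w2 w3 using ⟨w1, w2, w3⟩

end Law

/-! ### Almost surely the dependencies are well-founded -/

section WellFoundedness

open scoped ENNReal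

variable {V : Type*} {G : SimpleGraph V} [G.LocallyFinite]

lemma mem_depBall_of_walk {u v : V} (p : G.Walk v u) {n : ℕ} (hn : p.length ≤ n) :
    u ∈ depBall (nbrs G) n v := by
  induction p generalizing n with
  | nil => exact mem_depBall_self _ _ _
  | cons h p ih =>
    obtain ⟨m, rfl⟩ : ∃ m, n = m + 1 := ⟨n - 1, by simp at hn; omega⟩
    refine Set.mem_insert_of_mem _ (Set.mem_biUnion ((G.mem_neighborFinset _ _).2 h) (ih ?_))
    simpa using hn

variable (G) in
lemma countable_of_connected (hG : G.Connected) : Countable V := by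
  obtain ⟨o⟩ := hG.nonempty
  rw [← Set.countable_univ_iff]
  refine (Set.countable_iUnion fun n => (finite_depBall (nbrs G) n o).countable).mono ?_
  intro u _
  obtain ⟨p⟩ := hG.preconnected o u
  exact Set.mem_iUnion.2 ⟨_, mem_depBall_of_walk p le_rfl⟩

/-- The clock at `v` rings during the time interval `(a, b]`. -/
def ringsIn (a b : ℝ) (v : V) : Set (GlauberSample V) := {w | ∃ k, w.ringTime v k ∈ Set.Ioc a b}

variable (G) in
/-- There is a simple path with `n` edges which starts at `v`, avoids `A`, and all of whose clocks
ring during `(a, b]`. -/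
def ringPath (a b : ℝ) : ℕ → Set V → V → Set (GlauberSample V)
  | 0, _, v => ringsIn a b v
  | n + 1, A, v => ringsIn a b v ∩
      ⋃ y ∈ G.neighborFinset v, ⋃ _ : y ∉ insert v A, ringPath a b n (insert v A) y

lemma measurableSet_ringsIn (a b : ℝ) (v : V) : MeasurableSet[siteAlg {v}] (ringsIn a b v) := by
  rw [ringsIn, Set.ofPred_exists]
  refine @MeasurableSet.iUnion _ _ (siteAlg {v}) _ _ fun k => ?_
  have h := @measurable_ringTime_comp V _ (siteAlg {v}) id v
    (measurable_site (Set.mem_singleton v)) k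
  exact h measurableSet_Ioc

lemma glauberLaw_ringsIn_le (a b : ℝ) (v : V) :
    glauberLaw V (ringsIn a b v) ≤ ENNReal.ofReal (b - a) * ringBound b := by
  have hm : MeasurableSet {x | ∃ k, clockRing x k ∈ Set.Ioc a b} := by
    rw [Set.ofPred_exists]
    exact .iUnion fun k => measurable_clockRing k measurableSet_Ioc
  have := (measurePreserving_clock v).measure_preimage hm.nullMeasurableSet
  exact this.trans_le (clockLaw_exists_ring_le a b)

/-- The avoided set makes the continuation of a path depend only on fresh sites, hence independent
of the ring at its first vertex. -/
lemma measurableSet_ringPath (a b : ℝ) (n : ℕ) (A : Set V) (v : V) (hv : v ∉ A) :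
    MeasurableSet[siteAlg Aᶜ] (ringPath G a b n A v) := by
  induction n generalizing A v with
  | zero => exact siteAlg_mono (Set.singleton_subset_iff.2 hv) _ (measurableSet_ringsIn a b v)
  | succ n ih =>
    refine @MeasurableSet.inter _ (siteAlg Aᶜ) _ _
      (siteAlg_mono (Set.singleton_subset_iff.2 hv) _ (measurableSet_ringsIn a b v)) ?_
    refine Finset.measurableSet_biUnion (m := siteAlg Aᶜ) _ fun y _ =>
      @MeasurableSet.iUnion _ _ (siteAlg Aᶜ) _ _ fun hy => ?_
    exact siteAlg_mono (Set.compl_subset_compl.2 (Set.subset_insert v A)) _ (ih _ y hy)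

lemma glauberLaw_ringPath_le {d : ℕ} (hreg : G.IsRegularOfDegree d) {a b : ℝ}
    (hab : d * (ENNReal.ofReal (b - a) * ringBound b) ≤ 2⁻¹) (n : ℕ) (A : Set V) (v : V)
    (hv : v ∉ A) : glauberLaw V (ringPath G a b n A v) ≤ 2⁻¹ ^ n := by
  -- The bound with the factor `d` is what the union over at most `d` next vertices consumes; the
  -- second bound is carried along because the first is vacuous for `d = 0`.
  suffices h : d * glauberLaw V (ringPath G a b n A v) ≤ 2⁻¹ ^ (n + 1) ∧
      glauberLaw V (ringPath G a b n A v) ≤ 2⁻¹ ^ n from h.2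
  induction n generalizing A v with
  | zero =>
    rw [zero_add, pow_one, pow_zero]
    exact ⟨(mul_le_mul_right (glauberLaw_ringsIn_le a b v) _).trans hab, prob_le_one⟩
  | succ n ih =>
    set U := ⋃ y ∈ G.neighborFinset v, ⋃ _ : y ∉ insert v A, ringPath G a b n (insert v A) y
      with hU
    have hUm : MeasurableSet[siteAlg (insert v A)ᶜ] U :=
      Finset.measurableSet_biUnion (m := siteAlg (insert v A)ᶜ) _ fun y _ =>
        @MeasurableSet.iUnion _ _ (siteAlg (insert v A)ᶜ) _ _ fun hy =>
          measurableSet_ringPath a b n _ y hy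
    have heq : glauberLaw V (ringPath G a b (n + 1) A v) =
        glauberLaw V (ringsIn a b v) * glauberLaw V U :=
      glauberLaw_inter (by simp) (measurableSet_ringsIn a b v) hUm
    have hy : ∀ y, d * glauberLaw V (⋃ _ : y ∉ insert v A, ringPath G a b n (insert v A) y) ≤
        2⁻¹ ^ (n + 1) := by
      intro y
      by_cases hy : y ∈ insert v A
      · simp [hy]
      · simpa [hy] using (ih (insert v A) y hy).1
    have hUle : glauberLaw V U ≤ 2⁻¹ ^ (n + 1) := by
      rcases Nat.eq_zero_or_pos d with rfl | hd
      · have : G.neighborFinset v = ∅ := by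
          rw [← Finset.card_eq_zero, G.card_neighborFinset_eq_degree, hreg v]
        simp [hU, this]
      have hd0 : (d : ℝ≥0∞) ≠ 0 := by exact_mod_cast hd.ne'
      rw [← ENNReal.mul_le_mul_iff_right hd0 (ENNReal.natCast_ne_top d)]
      calc d * glauberLaw V U
          ≤ d * ∑ y ∈ G.neighborFinset v,
              glauberLaw V (⋃ _ : y ∉ insert v A, ringPath G a b n (insert v A) y) := by
            gcongr
            exact measure_biUnion_finset_le _ _
        _ ≤ ∑ y ∈ G.neighborFinset v, 2⁻¹ ^ (n + 1) := by
            rw [Finset.mul_sum]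
            exact Finset.sum_le_sum fun y _ => hy y
        _ = d * 2⁻¹ ^ (n + 1) := by
            rw [Finset.sum_const, G.card_neighborFinset_eq_degree, hreg v, nsmul_eq_mul]
    rw [heq]
    refine ⟨?_, (mul_le_mul' prob_le_one hUle).trans_eq (one_mul _)⟩
    calc d * (glauberLaw V (ringsIn a b v) * glauberLaw V U)
        ≤ (d * (ENNReal.ofReal (b - a) * ringBound b)) * 2⁻¹ ^ (n + 1) := by
          rw [← mul_assoc]
          gcongr
          exact glauberLaw_ringsIn_le a b v
      _ ≤ 2⁻¹ * 2⁻¹ ^ (n + 1) := by gcongr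
      _ = 2⁻¹ ^ (n + 1 + 1) := (pow_succ' _ _).symm

/-- Rational end points leave only countably many windows, so one null set serves them all. -/
lemma ae_exists_notMem_ringPath [Countable V] {d : ℕ} (hreg : G.IsRegularOfDegree d) :
    ∀ᵐ w ∂(glauberLaw V), ∀ a b : ℚ, d * (ENNReal.ofReal (b - a) * ringBound b) ≤ 2⁻¹ →
      ∀ v, ∃ n, w ∉ ringPath G a b n ∅ v := by
  refine ae_all_iff.2 fun a => ae_all_iff.2 fun b => Filter.eventually_imp_distrib_left.2 fun hab =>
    ae_all_iff.2 fun v => ?_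
  rw [ae_iff]
  simp only [not_exists, not_not]
  refine le_antisymm (ge_of_tendsto' (ENNReal.tendsto_pow_atTop_nhds_zero_of_lt_one
    (r := 2⁻¹) (by simp)) fun n => ?_) zero_le
  exact (measure_mono fun w (hw : ∀ n, w ∈ ringPath G a b n ∅ v) => hw n).trans
    (glauberLaw_ringPath_le hreg hab n ∅ v (Set.notMem_empty v))

lemma mem_ringPath_of_isPath {w : GlauberSample V} {a b : ℝ} {u v : V} (p : G.Walk v u)
    (hp : p.IsPath) (hw : ∀ x ∈ p.support, w ∈ ringsIn a b x) (n : ℕ) (hn : n ≤ p.length)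
    (A : Set V) (hA : ∀ x ∈ p.support, x ∉ A) : w ∈ ringPath G a b n A v := by
  induction p generalizing n A with
  | nil =>
    obtain rfl : n = 0 := by simpa using hn
    exact hw _ (by simp)
  | @cons v y u h p ih =>
    cases n with
    | zero => exact hw _ (by simp)
    | succ n =>
      rw [SimpleGraph.Walk.cons_isPath_iff] at hp
      have hA' : ∀ x ∈ p.support, x ∉ insert v A := by
        rintro x hx (rfl | hxA)
        · exact hp.2 hx
        · exact hA x (by simp [hx]) hxA
      refine ⟨hw _ (by simp), Set.mem_iUnion₂.2 ⟨y, (G.mem_neighborFinset _ _).2 h,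
        Set.mem_iUnion.2 ⟨hA' y p.start_mem_support, ?_⟩⟩⟩
      exact ih hp.1 (fun x hx => hw x (by simp [hx])) n (by simpa using hn) _ hA'

lemma ringBound_mono {b c : ℝ} (h : b ≤ c) : ringBound b ≤ ringBound c :=
  ENNReal.tsum_le_tsum fun k => by gcongr

lemma exists_rat_window (d : ℕ) (l : ℝ) : ∃ a b : ℚ, (a : ℝ) < l ∧ l < b ∧
    d * (ENNReal.ofReal (b - a) * ringBound b) ≤ 2⁻¹ := by
  have hC : (d : ℝ≥0∞) * ringBound (l + 1) ≠ ∞ :=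
    ENNReal.mul_ne_top (ENNReal.natCast_ne_top d) (ringBound_ne_top _)
  have ht : Tendsto (fun ε : ℝ => ENNReal.ofReal (2 * ε) * (d * ringBound (l + 1))) (𝓝[>] 0)
      (𝓝 0) := by
    have h1 : Tendsto (fun ε : ℝ => ENNReal.ofReal (2 * ε)) (𝓝[>] 0) (𝓝 0) := by
      have : Continuous fun ε : ℝ => ENNReal.ofReal (2 * ε) :=
        ENNReal.continuous_ofReal.comp (continuous_const.mul continuous_id)
      simpa using (this.tendsto 0).mono_left nhdsWithin_le_nhds
    simpa using ENNReal.Tendsto.mul_const h1 (.inr hC)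
  have hsmall := ht.eventually (gt_mem_nhds (show (0 : ℝ≥0∞) < 2⁻¹ by simp))
  have hlt : ∀ᶠ ε : ℝ in 𝓝[>] 0, ε < 1 :=
    mem_nhdsWithin_of_mem_nhds (gt_mem_nhds one_pos)
  obtain ⟨ε, hε, hε1, hε0⟩ := (hsmall.and (hlt.and self_mem_nhdsWithin)).exists
  have hε0 : 0 < ε := hε0
  obtain ⟨a, ha, ha'⟩ := exists_rat_btwn (show l - ε < l by linarith)
  obtain ⟨b, hb, hb'⟩ := exists_rat_btwn (show l < l + ε by linarith)
  refine ⟨a, b, ha', hb, le_trans ?_ hε.le⟩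
  rw [mul_left_comm]
  gcongr
  · linarith
  · exact ringBound_mono (by linarith)

/-- A descending chain has strictly decreasing, bounded ring times, so from some index on all of its
vertices ring in a short window around the limit. They are joined to each other by walks of ringing
vertices; shortening these to simple paths bounds their distance from the starting vertex. -/
lemma wellFounded_spinDep {w : GlauberSample V} (hw : RegularClocks w) {d : ℕ}
    (h : ∀ a b : ℚ, d * (ENNReal.ofReal (b - a) * ringBound b) ≤ 2⁻¹ →
      ∀ v, ∃ n, w ∉ ringPath G a b n ∅ v) : WellFounded (SpinDep (nbrs G) w) := by
  classical
  rw [wellFounded_iff_isEmpty_descending_chain]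
  refine ⟨fun ⟨f, hf⟩ => ?_⟩
  choose k hk hk' using fun n => (hf n).2
  set T : ℕ → ℝ := fun n => w.ringTime (f n).1 (k n) with hT
  have hadj : ∀ n, G.Adj (f n).1 (f (n + 1)).1 := fun n =>
    (G.mem_neighborFinset _ _).1 (hf n).1
  have hanti : StrictAnti T := by
    -- The consulted spin is the one after ring `k (n + 1)` of the neighbour, which has therefore
    -- occurred by time `T n`; adjacent vertices never ring at the same time.
    refine strictAnti_nat_of_succ_lt fun n => lt_of_le_of_ne ?_ (hw.ne _ _ (hadj n).ne' _ _)
    refine hw.lt_ringCount_iff.1 ?_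
    rw [← hk' n, hk (n + 1)]
    exact Nat.lt_succ_self _
  have hbdd : BddBelow (Set.range T) := ⟨0, by rintro _ ⟨n, rfl⟩; exact (hw.pos _ _).le⟩
  obtain ⟨a, b, ha, hb, hab⟩ := exists_rat_window d (⨅ n, T n)
  obtain ⟨n₀, hn₀⟩ := eventually_atTop.1
    ((tendsto_atTop_ciInf hanti.antitone hbdd).eventually (gt_mem_nhds hb))
  have hring : ∀ n, w ∈ ringsIn a b (f (n₀ + n)).1 := fun n =>
    ⟨k (n₀ + n), ha.trans_le (ciInf_le hbdd _), (hn₀ _ (by omega)).le⟩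
  obtain ⟨N, hN⟩ := h a b hab (f n₀).1
  have hwalk : ∀ n, ∃ p : G.Walk (f n₀).1 (f (n₀ + n)).1, ∀ x ∈ p.support, w ∈ ringsIn a b x := by
    intro n
    induction n with
    | zero => exact ⟨.nil, by simpa using hring 0⟩
    | succ n ih =>
      obtain ⟨p, hp⟩ := ih
      refine ⟨p.concat (hadj (n₀ + n)), fun x hx => ?_⟩
      rw [SimpleGraph.Walk.support_concat, List.mem_append,
        List.mem_singleton] at hx
      rcases hx with hx | rfl
      · exact hp x hx
      · exact hring (n + 1)
  have hball : ∀ n, (f (n₀ + n)).1 ∈ depBall (nbrs G) N (f n₀).1 := by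
    intro n
    obtain ⟨p, hp⟩ := hwalk n
    have hp' : ∀ x ∈ p.bypass.support, w ∈ ringsIn a b x := fun x hx =>
      hp x (p.support_bypass_subset_support hx)
    refine mem_depBall_of_walk p.bypass ?_
    by_contra hlt
    exact hN (mem_ringPath_of_isPath p.bypass p.bypass_isPath hp' N (not_le.1 hlt).le ∅
      fun x _ => Set.notMem_empty x)
  -- A finite ball has only finitely many rings before `T n₀`, whereas the chain uses infinitely
  -- many different ones.
  have hfin : (⋃ v ∈ depBall (nbrs G) N (f n₀).1,
      (fun j => (v, j)) '' Set.Iio (ringCount w v (T n₀))).Finite :=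
    (finite_depBall _ _ _).biUnion fun v _ => (Set.finite_Iio _).image _
  refine Set.infinite_of_injective_forall_mem (f := fun n => ((f (n₀ + n)).1, k (n₀ + n)))
    (fun m n hmn => ?_) (fun n => ?_) hfin
  · simp only [Prod.mk.injEq] at hmn
    have : T (n₀ + m) = T (n₀ + n) := by simp only [hT, hmn]
    have := hanti.injective this
    omega
  · refine Set.mem_biUnion (hball n) ⟨k (n₀ + n), ?_, rfl⟩
    exact hw.lt_ringCount_iff.2 (hanti.antitone (by omega : n₀ ≤ n₀ + n))

lemma ae_regular_wellFounded (hG : G.Connected) {d : ℕ} (hreg : G.IsRegularOfDegree d) :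
    ∀ᵐ w ∂(glauberLaw V), RegularClocks w ∧ WellFounded (SpinDep (nbrs G) w) := by
  have := countable_of_connected G hG
  filter_upwards [ae_regularClocks, ae_exists_notMem_ringPath hreg] with w h1 h2
  exact ⟨h1, wellFounded_spinDep h1 h2⟩

end WellFoundedness

/-! ### Branches of a regular tree -/

section Branches

/-- Extending geodesics from `o` to `p` and to `q` by one edge gives two paths from `o` to `v`; in a
tree they coincide, and so do their penultimate vertices. -/
lemma parent_unique {V : Type*} {G : SimpleGraph V} (hG : G.IsTree) {o v p q : V}
    (hp : G.Adj p v) (hq : G.Adj q v)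
    (hpd : G.dist o p + 1 = G.dist o v) (hqd : G.dist o q + 1 = G.dist o v) : p = q := by
  obtain ⟨P, hP⟩ := hG.connected.exists_walk_length_eq_dist o p
  obtain ⟨Q, hQ⟩ := hG.connected.exists_walk_length_eq_dist o q
  have hP' : (P.concat hp).IsPath := SimpleGraph.Walk.isPath_of_length_eq_dist _ (by simp [hP, hpd])
  have hQ' : (Q.concat hq).IsPath := SimpleGraph.Walk.isPath_of_length_eq_dist _ (by simp [hQ, hqd])
  have := (hG.existsUnique_path o v).unique hP' hQ'
  have := congrArg SimpleGraph.Walk.penultimate this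
  simpa using this

variable {V : Type*} (G : SimpleGraph V) [G.LocallyFinite] {m : ℕ}

open scoped Classical in
/-- An enumeration of the neighbours of `v` other than `p`. -/
noncomputable def child (m : ℕ) (p v : V) (i : Fin m) : V :=
  if h : ((G.neighborFinset v).erase p).card = m then
    (((G.neighborFinset v).erase p).equivFinOfCardEq h).symm i
  else v

/-- The dart reached from `δ` by following a list of child indices (the last index of the list is
followed first). -/
noncomputable def branchDart (δ : V × V) : List (Fin m) → V × V
  | [] => δ
  | i :: l => ((branchDart δ l).2, child G m (branchDart δ l).1 (branchDart δ l).2 i)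

/-- The end point of `branchDart`. -/
noncomputable def branch (δ : V × V) (l : List (Fin m)) : V := (branchDart G δ l).2

variable {G}

open scoped Classical in
lemma card_erase_neighbor (hreg : G.IsRegularOfDegree (m + 1)) {p v : V} (h : G.Adj p v) :
    ((G.neighborFinset v).erase p).card = m := by
  rw [Finset.card_erase_of_mem ((G.mem_neighborFinset v p).2 h.symm),
    G.card_neighborFinset_eq_degree, hreg v, Nat.add_sub_cancel]

lemma child_injective (hreg : G.IsRegularOfDegree (m + 1)) {p v : V} (h : G.Adj p v) :
    Function.Injective (child G m p v) := by
  intro i j hij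
  classical
  simpa [child, card_erase_neighbor hreg h, Subtype.val_inj] using hij

lemma sum_neighbors_eq (hreg : G.IsRegularOfDegree (m + 1)) {p v : V} (h : G.Adj p v)
    (F : V → ℤ) : ∑ y ∈ G.neighborFinset v, F y = F p + ∑ i, F (child G m p v i) := by
  classical
  have hp : p ∈ G.neighborFinset v := (G.mem_neighborFinset v p).2 h.symm
  rw [← Finset.add_sum_erase _ _ hp, ← Finset.sum_coe_sort]
  simp only [child, card_erase_neighbor hreg h, dite_true]
  rw [← Equiv.sum_comp (((G.neighborFinset v).erase p).equivFinOfCardEq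
    (card_erase_neighbor hreg h)).symm]

lemma child_mem (hreg : G.IsRegularOfDegree (m + 1)) {p v : V} (h : G.Adj p v) (i : Fin m) :
    G.Adj v (child G m p v i) ∧ child G m p v i ≠ p := by
  classical
  simp only [child, card_erase_neighbor hreg h, dite_true]
  have := (((G.neighborFinset v).erase p).equivFinOfCardEq (card_erase_neighbor hreg h)).symm i |>.2
  rw [Finset.mem_erase, G.mem_neighborFinset] at this
  exact this.symm

lemma branchDart_append (δ : V × V) (l l₀ : List (Fin m)) :
    branchDart G δ (l ++ l₀) = branchDart G (branchDart G δ l₀) l := by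
  induction l with
  | nil => rfl
  | cons i l ih => simp only [List.cons_append, branchDart, ih]

lemma branch_append (δ : V × V) (l l₀ : List (Fin m)) :
    branch G δ (l ++ l₀) = branch G (branchDart G δ l₀) l := by
  rw [branch, branchDart_append, branch]

lemma branchDart_adj (hreg : G.IsRegularOfDegree (m + 1)) {δ : V × V} (hδ : G.Adj δ.1 δ.2)
    (l : List (Fin m)) : G.Adj (branchDart G δ l).1 (branchDart G δ l).2 := by
  induction l with
  | nil => exact hδ
  | cons i l ih => exact (child_mem hreg ih i).1

/-- Distances from `δ.1` change by one along an edge of a tree. A child closer to `δ.1` would be a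
second parent, but children differ from the parent. -/
lemma dist_branchDart (hG : G.IsTree) (hreg : G.IsRegularOfDegree (m + 1)) {δ : V × V}
    (hδ : G.Adj δ.1 δ.2) (l : List (Fin m)) :
    G.dist δ.1 (branchDart G δ l).1 = l.length ∧
      G.dist δ.1 (branchDart G δ l).2 = l.length + 1 := by
  induction l with
  | nil => simpa [branchDart] using hδ
  | cons i l ih =>
    have hadj := branchDart_adj hreg hδ l
    obtain ⟨h1, h2⟩ := child_mem hreg hadj i
    refine ⟨ih.2, ?_⟩
    simp only [branchDart, List.length_cons]
    rcases hG.dist_eq_dist_add_one_of_adj δ.1 h1 with h | h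
    · exact absurd (parent_unique hG (o := δ.1) h1.symm hadj (by omega) (by omega)) h2
    · omega

lemma dist_branch (hG : G.IsTree) (hreg : G.IsRegularOfDegree (m + 1)) {δ : V × V}
    (hδ : G.Adj δ.1 δ.2) (l : List (Fin m)) :
    G.dist δ.1 (branch G δ l) = l.length + 1 ∧ G.dist δ.2 (branch G δ l) = l.length := by
  have h1 := (dist_branchDart hG hreg hδ l).2
  refine ⟨h1, le_antisymm ?_ ?_⟩
  · clear h1
    induction l with
    | nil => simp [branch, branchDart]
    | cons i l ih =>
      have h := (child_mem hreg (branchDart_adj hreg hδ l) i).1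
      have ht := hG.connected.dist_triangle (u := δ.2) (v := branch G δ l)
        (w := branch G δ (i :: l))
      have hd : G.dist (branch G δ l) (branch G δ (i :: l)) = 1 :=
        SimpleGraph.dist_eq_one_iff_adj.2 h
      simp only [List.length_cons]
      omega
  · have ht := hG.connected.dist_triangle (u := δ.1) (v := δ.2) (w := branch G δ l)
    rw [SimpleGraph.dist_eq_one_iff_adj.2 hδ] at ht
    have h1 : G.dist δ.1 (branch G δ l) = l.length + 1 := h1
    omega

lemma branch_injective (hG : G.IsTree) (hreg : G.IsRegularOfDegree (m + 1)) {δ : V × V}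
    (hδ : G.Adj δ.1 δ.2) : Function.Injective (branch G (m := m) δ) := by
  intro l l' h
  have hlen : l.length = l'.length := by
    have h1 := (dist_branch hG hreg hδ l).2
    rw [h, (dist_branch hG hreg hδ l').2] at h1
    exact h1.symm
  induction l generalizing l' with
  | nil => exact (List.length_eq_zero_iff.1 hlen.symm).symm
  | cons i l ih =>
    cases l' with
    | nil => simp at hlen
    | cons j l' =>
      have hl := child_mem hreg (branchDart_adj hreg hδ l) i
      have hl' := child_mem hreg (branchDart_adj hreg hδ l') j
      have hdl := (dist_branch hG hreg hδ l).1
      have hdl' := (dist_branch hG hreg hδ l').1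
      have hd := (dist_branch hG hreg hδ (i :: l)).1
      have hd' := (dist_branch hG hreg hδ (j :: l')).1
      have heq : branch G δ l = branch G δ l' := by
        refine parent_unique hG (o := δ.1) (v := branch G δ (i :: l)) hl.1 ?_ ?_ ?_
        · rw [h]; exact hl'.1
        · rw [hd, hdl]; simp
        · rw [h, hd', hdl']; simp
      obtain rfl := ih heq (by simpa using hlen)
      rw [child_injective hreg (branchDart_adj hreg hδ l) h]

/-- Each branch consists of vertices strictly closer to its own root than to the other end of the
edge. -/
lemma branch_ne_branch_swap (hG : G.IsTree) (hreg : G.IsRegularOfDegree (m + 1)) {δ : V × V}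
    (hδ : G.Adj δ.1 δ.2) (l l' : List (Fin m)) : branch G δ l ≠ branch G δ.swap l' := by
  intro h
  have h1 := dist_branch hG hreg hδ l
  have h2 := dist_branch hG hreg (δ := δ.swap) hδ.symm l'
  rw [← h] at h2
  simp only [Prod.fst_swap, Prod.snd_swap] at h2
  omega

/-- Neighbourhoods in the rooted tree in which every vertex has `m` children. -/
def rootedNbrs (m : ℕ) : List (Fin m) → Finset (List (Fin m))
  | [] => Finset.univ.image fun i => [i]
  | i :: l => insert l (Finset.univ.image fun j => j :: i :: l)

lemma sum_rootedNbrs_nil (F : List (Fin m) → ℤ) :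
    ∑ y ∈ rootedNbrs m [], F y = ∑ i, F [i] := by
  rw [rootedNbrs, Finset.sum_image]
  intro i _ j _ h
  simpa using h

lemma sum_rootedNbrs_cons (F : List (Fin m) → ℤ) (i : Fin m) (l : List (Fin m)) :
    ∑ y ∈ rootedNbrs m (i :: l), F y = F l + ∑ j, F (j :: i :: l) := by
  rw [rootedNbrs, Finset.sum_insert, Finset.sum_image]
  · intro i _ j _ h
    simpa using h
  · rw [Finset.mem_image]
    rintro ⟨j, -, h⟩
    have := congrArg List.length h
    simp at this
    omega

lemma branch_adj_of_mem (hreg : G.IsRegularOfDegree (m + 1)) {δ : V × V} (hδ : G.Adj δ.1 δ.2)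
    (l : List (Fin m)) (y : List (Fin m)) (hy : y ∈ rootedNbrs m l) :
    branch G δ y ∈ nbrs G (branch G δ l) := by
  refine (G.mem_neighborFinset _ _).2 ?_
  cases l with
  | nil =>
    simp only [rootedNbrs, Finset.mem_image, Finset.mem_univ, true_and] at hy
    obtain ⟨i, rfl⟩ := hy
    exact (child_mem hreg hδ i).1
  | cons i l =>
    simp only [rootedNbrs, Finset.mem_insert, Finset.mem_image, Finset.mem_univ, true_and] at hy
    rcases hy with rfl | ⟨j, rfl⟩
    · exact (branchDart_adj hreg hδ (i :: y)).symm
    · exact (child_mem hreg (branchDart_adj hreg hδ (i :: l)) j).1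

lemma sum_nbrs_branch_nil (hreg : G.IsRegularOfDegree (m + 1)) {δ : V × V} (hδ : G.Adj δ.1 δ.2)
    (F : V → ℤ) : ∑ y ∈ nbrs G (branch G (m := m) δ []), F y =
      F δ.1 + ∑ i : Fin m, F (branch G δ [i]) :=
  sum_neighbors_eq hreg hδ F

lemma sum_nbrs_branch_cons (hreg : G.IsRegularOfDegree (m + 1)) {δ : V × V} (hδ : G.Adj δ.1 δ.2)
    (F : V → ℤ) (i : Fin m) (l : List (Fin m)) : ∑ y ∈ nbrs G (branch G δ (i :: l)), F y =
      F (branch G δ l) + ∑ j : Fin m, F (branch G δ (j :: i :: l)) :=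
  sum_neighbors_eq hreg (branchDart_adj hreg hδ (i :: l)) F

/-- Two copies of the rooted tree with `m` children at each vertex, with adjacent roots: the
`(m + 1)`-regular tree. -/
def doubleNbrs (m : ℕ) : Bool × List (Fin m) → Finset (Bool × List (Fin m))
  | (b, []) => insert (!b, []) (Finset.univ.image fun i => (b, [i]))
  | (b, i :: l) => insert (b, l) (Finset.univ.image fun j => (b, j :: i :: l))

variable (G) in
/-- The embedding of the double rooted tree at the edge `δ`. -/
noncomputable def doubleBranch (δ : V × V) (x : Bool × List (Fin m)) : V :=
  branch G (if x.1 then δ else δ.swap) x.2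

lemma doubleBranch_injective (hG : G.IsTree) (hreg : G.IsRegularOfDegree (m + 1)) {δ : V × V}
    (hδ : G.Adj δ.1 δ.2) : Function.Injective (doubleBranch G (m := m) δ) := by
  rintro ⟨b, l⟩ ⟨b', l'⟩ h
  cases b <;> cases b' <;> simp only [doubleBranch, if_true, Bool.false_eq_true, if_false] at h
  · rw [branch_injective hG hreg (δ := δ.swap) hδ.symm h]
  · exact absurd h.symm (branch_ne_branch_swap hG hreg hδ _ _)
  · exact absurd h (branch_ne_branch_swap hG hreg hδ _ _)
  · rw [branch_injective hG hreg hδ h]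

/-- The image of the double tree is closed under taking neighbours, so `approx_pull` applies;
surjectivity is not needed. -/
lemma sum_nbrs_doubleBranch (hreg : G.IsRegularOfDegree (m + 1)) {δ : V × V}
    (hδ : G.Adj δ.1 δ.2) (x : Bool × List (Fin m)) (F : V → ℤ) :
    ∑ y ∈ nbrs G (doubleBranch G δ x), F y = ∑ y ∈ doubleNbrs m x, F (doubleBranch G δ y) := by
  obtain ⟨b, l⟩ := x
  have hδ' : G.Adj (if b then δ else δ.swap).1 (if b then δ else δ.swap).2 := by
    cases b
    · exact hδ.symm
    · exact hδ
  cases l with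
  | nil =>
    rw [doubleNbrs, Finset.sum_insert (by simp), Finset.sum_image (fun i _ j _ h => by simpa using h)]
    refine (sum_nbrs_branch_nil hreg hδ' F).trans ?_
    cases b <;> rfl
  | cons i l =>
    rw [doubleNbrs, Finset.sum_insert, Finset.sum_image (fun i _ j _ h => by simpa using h)]
    · exact sum_nbrs_branch_cons hreg hδ' F i l
    · rw [Finset.mem_image]
      rintro ⟨j, -, h⟩
      have := congrArg (fun x => x.2.length) h
      simp at this
      omega

end Branches

/-! ### No consensus -/

section Consensus

open scoped ENNReal

variable {I V : Type*}

lemma glauberLaw_settleSet_flip (nb : I → Finset I) {e : I → ℝ → ℤ} (he : ∀ v, Measurable (e v))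
    (v : I) (s : Spin) :
    glauberLaw I (settleSet nb (fun v t => -e v t) v (-s)) = glauberLaw I (settleSet nb e v s) := by
  have hm : MeasurableSet (settleSet nb (fun v t => -e v t) v (-s)) :=
    measurableSet_settleSet nb (fun v => (he v).neg) v (-s)
  rw [← measurePreserving_flipSample.measure_preimage hm.nullMeasurableSet]
  congr 1
  ext w
  simp only [settleSet, Set.mem_preimage, Set.mem_ofPred_eq, approx_flip, neg_inj]

lemma measurableSet_approx_eq (nb : I → Finset I) {e : I → ℝ → ℤ} (he : ∀ v, Measurable (e v))
    (n : ℕ) (v : I) (k : ℕ) (s : Spin) :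
    MeasurableSet[siteAlg (depBall nb n v)] {w | approx nb e w n v k = s} := by
  have := @measurable_approx_comp I _ (siteAlg (depBall nb n v)) nb e he id n v k
    fun u hu => measurable_site hu
  exact this (measurableSet_singleton s)

/-- The global flip preserves the law and, in zero field, exchanges the two possible values. -/
lemma glauberLaw_approx_eq (nb : I → Finset I) (n : ℕ) (v : I) (k : ℕ) (s : Spin) :
    glauberLaw I {w | approx nb (fun _ _ => 0) w n v k = s} = 2⁻¹ := by
  have hm : ∀ s, MeasurableSet {w | approx nb (fun _ _ => 0) w n v k = s} := fun s =>
    siteAlg_le _ _ (measurableSet_approx_eq nb (fun _ => measurable_const) n v k s)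
  have hflip : glauberLaw I {w | approx nb (fun _ _ => 0) w n v k = s}ᶜ =
      glauberLaw I {w | approx nb (fun _ _ => 0) w n v k = s} := by
    rw [← measurePreserving_flipSample.measure_preimage (hm s).compl.nullMeasurableSet]
    congr 1
    ext w
    have := approx_flip nb (fun _ _ => 0) w n v k
    simp only [neg_zero] at this
    simp only [Set.mem_preimage, Set.mem_compl_iff, Set.mem_ofPred_eq, this]
    refine ⟨fun h => ?_, fun h => h ▸ (Spin.ne_neg _).symm⟩
    rw [← neg_neg (approx _ _ _ _ _ _), Spin.eq_neg_of_ne h, neg_neg]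
  have hsum := measure_add_measure_compl (μ := glauberLaw I) (hm s)
  rw [hflip, ← two_mul, measure_univ] at hsum
  exact ENNReal.eq_inv_of_mul_eq_one_left (by rwa [mul_comm] at hsum)

/-- The indicators of these events tend to zero pointwise, so their measures tend to zero. -/
lemma exists_measure_eventually_not_lt {Ω : Type*} [MeasurableSpace Ω] (μ : Measure Ω)
    [IsFiniteMeasure μ] {P : ℕ → Ω → Prop} (hP : ∀ k, MeasurableSet {ω | P k ω}) {δ : ℝ≥0∞}
    (hδ : 0 < δ) : ∃ k, μ {ω | (∀ᶠ j in atTop, P j ω) ∧ ¬ P k ω} < δ := by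
  have hE : MeasurableSet {ω | ∀ᶠ j in atTop, P j ω} := by
    simp only [eventually_atTop, Set.ofPred_exists, Set.ofPred_forall]
    exact .iUnion fun K => .iInter fun k => .iInter fun _ => hP k
  have h : Tendsto (fun k => μ {ω | (∀ᶠ j in atTop, P j ω) ∧ ¬ P k ω}) atTop (𝓝 (μ ∅)) := by
    refine tendsto_measure_of_ae_tendsto_indicator_of_isFiniteMeasure atTop .empty
      (fun k => hE.inter (hP k).compl) (.of_forall fun ω => ?_)
    by_cases hω : ∀ᶠ j in atTop, P j ω
    · filter_upwards [hω] with k hk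
      simp [hk]
    · exact .of_forall fun k => ⟨fun h => absurd h.1 hω, fun h => absurd h (Set.notMem_empty _)⟩
  rw [measure_empty] at h
  exact (h.eventually (gt_mem_nhds hδ)).exists

variable {G : SimpleGraph V} [G.LocallyFinite] {m : ℕ}

/-- Uniformly in the vertex, settling at `s` is well approximated by an event that depends on a
finite ball. -/
lemma exists_uniform_local_approx (hG : G.IsTree) (hreg : G.IsRegularOfDegree (m + 1)) (s : Spin)
    {δ : ℝ≥0∞} (hδ : 0 < δ) : ∃ n k, ∀ v : V,
      glauberLaw V (settleSet (nbrs G) (fun _ _ => 0) v s ∩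
        {w | approx (nbrs G) (fun _ _ => 0) w n v k ≠ s}) ≤ δ := by
  -- All estimates are made at one root of one model tree, which embeds at every vertex of `G`; this
  -- makes `n` and `k` independent of the vertex.
  set D : ℕ → ℕ → GlauberSample (Bool × List (Fin m)) → Prop := fun n k w =>
    approx (doubleNbrs m) (fun _ _ => 0) w n (true, []) k = s with hD
  have hDm : ∀ n k, MeasurableSet {w | D n k w} := fun n k =>
    siteAlg_le _ _ (measurableSet_approx_eq _ (fun _ => measurable_const) n _ k s)
  have hDm' : ∀ k, MeasurableSet {w | ∀ᶠ n in atTop, D n k w} := fun k => by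
    simp only [eventually_atTop, Set.ofPred_exists, Set.ofPred_forall]
    exact .iUnion fun K => .iInter fun n => .iInter fun _ => hDm n k
  -- Two limits are truncated in turn: first the ring index `k`, then, for that `k`, the iteration
  -- depth `n`.
  obtain ⟨k, hk⟩ := exists_measure_eventually_not_lt (glauberLaw (Bool × List (Fin m))) hDm'
    (ENNReal.half_pos hδ.ne')
  obtain ⟨n, hn⟩ := exists_measure_eventually_not_lt (glauberLaw (Bool × List (Fin m)))
    (fun n => hDm n k) (ENNReal.half_pos hδ.ne')
  refine ⟨n, k, fun v => ?_⟩
  obtain ⟨o, ho⟩ : (G.neighborFinset v).Nonempty := by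
    rw [← Finset.card_pos, G.card_neighborFinset_eq_degree, hreg v]
    exact Nat.succ_pos m
  have hδ' : G.Adj (o, v).1 (o, v).2 := ((G.mem_neighborFinset _ _).1 ho).symm
  have hmp := measurePreserving_pullSample (doubleBranch_injective (m := m) hG hreg hδ')
  have happ : ∀ w n k, approx (nbrs G) (fun _ _ => 0) w n v k = s ↔
      D n k (pullSample (doubleBranch G (o, v)) w) := fun w n k => by
    change _ ↔ approx (doubleNbrs m) _ _ _ _ _ = s
    rw [← approx_pull (nb := nbrs G) _ (sum_nbrs_doubleBranch hreg hδ')]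
    rfl
  set B := {w | (∀ᶠ k in atTop, ∀ᶠ n in atTop, D n k w) ∧ ¬ ∀ᶠ n in atTop, D n k w} ∪
    {w | (∀ᶠ n in atTop, D n k w) ∧ ¬ D n k w} with hB
  calc glauberLaw V (settleSet (nbrs G) (fun _ _ => 0) v s ∩
        {w | approx (nbrs G) (fun _ _ => 0) w n v k ≠ s})
      ≤ glauberLaw V (pullSample (doubleBranch G (o, v)) ⁻¹' B) := by
        refine measure_mono fun w hw => ?_
        simp only [settleSet, Set.mem_inter_iff, Set.mem_ofPred_eq, happ, ne_eq] at hw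
        rw [Set.mem_preimage, hB]
        by_cases h : ∀ᶠ n in atTop, D n k (pullSample (doubleBranch G (o, v)) w)
        · exact .inr ⟨h, hw.2⟩
        · exact .inl ⟨hw.1, h⟩
    _ ≤ glauberLaw (Bool × List (Fin m)) B := hmp.measure_preimage_le B
    _ ≤ δ / 2 + δ / 2 := (measure_union_le _ _).trans (add_le_add hk.le hn.le)
    _ = δ := ENNReal.add_halves δ

lemma exists_walk_of_mem_depBall {n : ℕ} {u v : V} (h : u ∈ depBall (nbrs G) n v) :
    ∃ p : G.Walk v u, p.length ≤ n := by
  induction n generalizing v with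
  | zero =>
    obtain rfl : u = v := h
    exact ⟨.nil, le_rfl⟩
  | succ n ih =>
    rcases h with rfl | h
    · exact ⟨.nil, Nat.zero_le _⟩
    · obtain ⟨y, hy, hu⟩ := Set.mem_iUnion₂.1 h
      obtain ⟨p, hp⟩ := ih hu
      exact ⟨.cons ((G.mem_neighborFinset _ _).1 hy) p, by simpa using hp⟩

lemma mem_depBall_comm {n : ℕ} {u v : V} (h : u ∈ depBall (nbrs G) n v) :
    v ∈ depBall (nbrs G) n u := by
  obtain ⟨p, hp⟩ := exists_walk_of_mem_depBall h
  exact mem_depBall_of_walk p.reverse (by simpa using hp)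

/-- Balls are finite and the graph is infinite, so a new centre can always be chosen outside the
balls around all points of the old ones. -/
lemma exists_disjoint_depBalls [Infinite V] (n N : ℕ) : ∃ f : Fin N → V,
    Pairwise fun i j => Disjoint (depBall (nbrs G) n (f i)) (depBall (nbrs G) n (f j)) := by
  induction N with
  | zero => exact ⟨Fin.elim0, fun i => i.elim0⟩
  | succ N ih =>
    obtain ⟨f, hf⟩ := ih
    have hfin : (⋃ i, ⋃ u ∈ depBall (nbrs G) n (f i), depBall (nbrs G) n u).Finite :=
      Set.finite_iUnion fun i => (finite_depBall _ _ _).biUnion fun u _ => finite_depBall _ _ _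
    obtain ⟨v, hv⟩ := hfin.exists_notMem
    have hdisj : ∀ i, Disjoint (depBall (nbrs G) n v) (depBall (nbrs G) n (f i)) := by
      refine fun i => Set.disjoint_left.2 fun u hu hu' => hv ?_
      exact Set.mem_iUnion.2 ⟨i, Set.mem_biUnion hu' (mem_depBall_comm hu)⟩
    refine ⟨Fin.cons v f, fun i j hij => ?_⟩
    induction i using Fin.cases with
    | zero =>
      induction j using Fin.cases with
      | zero => exact absurd rfl hij
      | succ j => simpa using hdisj j
    | succ i =>
      induction j using Fin.cases with
      | zero => simpa using (hdisj i).symm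
      | succ j => simpa using hf fun h => hij (by rw [h])

lemma infinite_of_regular (hG : G.IsTree) (hreg : G.IsRegularOfDegree (m + 1)) (hm : 0 < m) :
    Infinite V := by
  obtain ⟨v⟩ := hG.connected.nonempty
  obtain ⟨o, ho⟩ : (G.neighborFinset v).Nonempty := by
    rw [← Finset.card_pos, G.card_neighborFinset_eq_degree, hreg v]
    exact Nat.succ_pos m
  have : Nonempty (Fin m) := ⟨⟨0, hm⟩⟩
  exact Infinite.of_injective _ (branch_injective (m := m) hG hreg (δ := (v, o))
    ((G.mem_neighborFinset _ _).1 ho))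

/-- At `N` vertices with disjoint balls the local approximations are independent and all equal `s`
with probability `2⁻¹ ^ N`; the approximation error costs at most as much again. -/
lemma glauberLaw_consensus (hG : G.IsTree) (hreg : G.IsRegularOfDegree (m + 1)) (hm : 0 < m)
    (s : Spin) : glauberLaw V (⋂ v, settleSet (nbrs G) (fun _ _ => 0) v s) = 0 := by
  have := infinite_of_regular hG hreg hm
  have key : ∀ N : ℕ, glauberLaw V (⋂ v, settleSet (nbrs G) (fun _ _ => 0) v s) ≤
      2⁻¹ ^ N + 2⁻¹ ^ N := by
    intro N
    -- The error is shared among the `N` vertices; `N + 1` avoids dividing by zero.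
    have hδ : (0 : ℝ≥0∞) < 2⁻¹ ^ N / (N + 1) :=
      ENNReal.div_pos (pow_ne_zero _ (by simp)) (by finiteness)
    obtain ⟨n, k, h⟩ := exists_uniform_local_approx hG hreg s hδ
    obtain ⟨f, hf⟩ := exists_disjoint_depBalls (G := G) n N
    set A : Fin N → Set (GlauberSample V) := fun i =>
      {w | approx (nbrs G) (fun _ _ => 0) w n (f i) k = s} with hA
    have hsub : (⋂ v, settleSet (nbrs G) (fun _ _ => 0) v s) ⊆ (⋂ i ∈ Finset.univ, A i) ∪
        ⋃ i, settleSet (nbrs G) (fun _ _ => 0) (f i) s ∩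
          {w | approx (nbrs G) (fun _ _ => 0) w n (f i) k ≠ s} := by
      intro w hw
      by_cases h : ∀ i, w ∈ A i
      · exact .inl (by simpa using h)
      · obtain ⟨i, hi⟩ := not_forall.1 h
        exact .inr (Set.mem_iUnion.2 ⟨i, Set.mem_iInter.1 hw _, hi⟩)
    have h1 : glauberLaw V (⋂ i ∈ Finset.univ, A i) = 2⁻¹ ^ N := by
      rw [glauberLaw_biInter Finset.univ _ hf A fun i =>
        measurableSet_approx_eq _ (fun _ => measurable_const) n (f i) k s]
      simp [hA, glauberLaw_approx_eq]
    refine (measure_mono hsub).trans ((measure_union_le _ _).trans ?_)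
    rw [h1]
    gcongr
    calc _ ≤ ∑' i : Fin N, 2⁻¹ ^ N / ((N : ℝ≥0∞) + 1) :=
          (measure_iUnion_le _).trans (ENNReal.tsum_le_tsum fun i => h (f i))
      _ = N * (2⁻¹ ^ N / (N + 1)) := by simp
      _ ≤ (N + 1) * (2⁻¹ ^ N / (N + 1)) := by gcongr; exact le_self_add
      _ = 2⁻¹ ^ N := ENNReal.mul_div_cancel (by simp) (by finiteness)
  have ht : Tendsto (fun N : ℕ => (2⁻¹ : ℝ≥0∞) ^ N + 2⁻¹ ^ N) atTop (𝓝 (0 + 0)) :=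
    (ENNReal.tendsto_pow_atTop_nhds_zero_of_lt_one (by simp)).add
      (ENNReal.tendsto_pow_atTop_nhds_zero_of_lt_one (by simp))
  rw [add_zero] at ht
  exact le_antisymm (ge_of_tendsto' ht key) zero_le

end Consensus

/-! ### Ties -/

section Ties

open scoped ENNReal

variable {I V : Type*}

lemma Settles.unique {a : I → ℕ → Spin} {v : I} {s s' : Spin} (h : Settles a v s)
    (h' : Settles a v s') : s = s' := by
  obtain ⟨k, hk, hk'⟩ := (Eventually.and h h').exists
  rw [← hk, hk']

lemma Settles.mono {J : Type*} {a : I → ℕ → Spin} {b : J → ℕ → Spin} {v : I} {u : J}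
    (h : Settles a v 1) (hab : ∀ k, (a v k : ℤ) ≤ b u k) : Settles b u 1 := by
  filter_upwards [h] with k hk
  have := hab k
  rw [hk] at this
  exact Spin.eq_one_of_le (by simpa using this)

lemma Settles.anti {J : Type*} {a : I → ℕ → Spin} {b : J → ℕ → Spin} {v : I} {u : J}
    (h : Settles a v (-1)) (hab : ∀ k, (b u k : ℤ) ≤ a v k) : Settles b u (-1) := by
  filter_upwards [h] with k hk
  have := hab k
  rw [hk] at this
  rcases Int.units_eq_one_or (b u k) with h1 | h1
  · rw [h1] at this
    simp at this
  · exact h1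

lemma ae_frequently_coin_eq [Countable V] :
    ∀ᵐ w ∂(glauberLaw V), ∀ v (b : Spin), ∃ᶠ k in atTop, w.coin v k = b := by
  refine ae_all_iff.2 fun v => ae_all_iff.2 fun b => ?_
  refine (measurePreserving_coins v).quasiMeasurePreserving.ae
    (p := fun c => ∃ᶠ k in atTop, c k = b) ?_
  simp only [frequently_atTop]
  refine ae_all_iff.2 fun K => ?_
  rw [ae_iff]
  refine le_antisymm (ge_of_tendsto' (ENNReal.tendsto_pow_atTop_nhds_zero_of_lt_one
    (r := 2⁻¹) (by simp)) fun n => ?_) zero_le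
  have hbox : (Measure.infinitePi fun _ : ℕ => fairSpin)
      (Set.pi (Finset.Ico K (K + n)) fun _ => {-b}) = 2⁻¹ ^ n := by
    rw [Measure.infinitePi_pi _ fun _ _ => measurableSet_singleton _]
    simp [fairSpin_singleton]
  rw [← hbox]
  refine measure_mono fun c hc i hi => ?_
  have hc : ¬ ∃ k ≥ K, c k = b := hc
  have hne : c i ≠ b := fun h => hc ⟨i, (Finset.mem_Ico.1 hi).1, h⟩
  exact Spin.eq_neg_of_ne hne

variable {G : SimpleGraph V} [G.LocallyFinite]

lemma RegularClocks.eventually_localField_eq {w : GlauberSample V} (hw : RegularClocks w)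
    {a : V → ℕ → Spin} {v : V} {l : V → Spin} (hl : ∀ y ∈ nbrs G v, Settles a y (l y)) :
    ∀ᶠ k in atTop, localField (nbrs G) (fun _ _ => 0) w a v (w.ringTime v k) =
      ∑ y ∈ nbrs G v, (l y : ℤ) := by
  have h := (eventually_all_finset (nbrs G v)).2 fun y hy =>
    ((hw.tendsto_ringCount y).comp (hw.tendsto v)).eventually (hl y hy)
  filter_upwards [h] with k hk
  rw [localField, add_zero]
  exact Finset.sum_congr rfl fun y hy => by rw [← hk y hy]; rfl

/-- In a limiting tie the spin eventually copies its coin, and infinitely many coins show the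
opposite of the supposed limit. -/
lemma sum_ne_zero_of_settles {w : GlauberSample V} (hw : RegularClocks w)
    (hcoin : ∀ v (b : Spin), ∃ᶠ k in atTop, w.coin v k = b) {a : V → ℕ → Spin}
    (ha : IsSkeleton (nbrs G) (fun _ _ => 0) w a) {l : V → Spin} (hl : ∀ v, Settles a v (l v))
    (v : V) : ∑ y ∈ nbrs G v, (l y : ℤ) ≠ 0 := by
  intro h0
  have h1 := hw.eventually_localField_eq (G := G) (v := v) fun y _ => hl y
  have h2 := (tendsto_add_atTop_nat 1).eventually (hl v)
  obtain ⟨k, hk, hk1, hk2⟩ := ((hcoin v (-l v)).and_eventually (h1.and h2)).exists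
  rw [ha.succ, hk1, h0, heatBath_zero, hk] at hk2
  exact Spin.ne_neg _ hk2.symm

lemma sum_pos_of_settles {w : GlauberSample V} (hw : RegularClocks w)
    (hcoin : ∀ v (b : Spin), ∃ᶠ k in atTop, w.coin v k = b) {a : V → ℕ → Spin}
    (ha : IsSkeleton (nbrs G) (fun _ _ => 0) w a) {l : V → Spin} (hl : ∀ v, Settles a v (l v))
    (v : V) (hv : l v = 1) : 0 < ∑ y ∈ nbrs G v, (l y : ℤ) := by
  refine lt_of_le_of_ne (not_lt.1 fun hneg => ?_) (sum_ne_zero_of_settles hw hcoin ha hl v).symm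
  have h1 := hw.eventually_localField_eq (G := G) (v := v) fun y _ => hl y
  have h2 := (tendsto_add_atTop_nat 1).eventually (hl v)
  obtain ⟨k, hk1, hk2⟩ := (h1.and h2).exists
  rw [ha.succ, hk1, heatBath_of_neg hneg, hv] at hk2
  exact absurd hk2 (by decide)

end Ties

/-! ### Dynamics on a branch -/

section BranchDynamics

open scoped ENNReal

variable {V : Type*} {G : SimpleGraph V} [G.LocallyFinite] {m : ℕ}

/-- The external field `η` at the root. -/
def rootField (m : ℕ) (η : ℝ → ℤ) : List (Fin m) → ℝ → ℤ
  | [], t => η t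
  | _ :: _, _ => 0

/-- The event that the root of the branch settles at `s` under the field `η` at the root. -/
def branchSet (m : ℕ) (η : ℝ → ℤ) (s : Spin) : Set (GlauberSample (List (Fin m))) :=
  settleSet (rootedNbrs m) (rootField m η) [] s

lemma measurable_rootField {η : ℝ → ℤ} (hη : Measurable η) (l : List (Fin m)) :
    Measurable (rootField m η l) := by
  cases l
  · exact hη
  · exact measurable_const

lemma measurableSet_branchSet {η : ℝ → ℤ} (hη : Measurable η) (s : Spin) :
    MeasurableSet (branchSet m η s) :=
  measurableSet_settleSet _ (measurable_rootField hη) _ _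

lemma rootField_mono {η η' : ℝ → ℤ} (h : ∀ t, 0 < t → η t ≤ η' t) (l : List (Fin m)) {t : ℝ}
    (ht : 0 < t) : rootField m η l t ≤ rootField m η' l t := by
  cases l
  · exact h t ht
  · exact le_rfl

lemma rootField_neg (η : ℝ → ℤ) :
    rootField m (fun t => -η t) = fun l t => -rootField m η l t := by
  funext l t
  cases l <;> simp [rootField]

/-- The field which is `1` up to time `T` and `-1` afterwards. -/
noncomputable def delayField (T : ℕ) (t : ℝ) : ℤ := if t < T then 1 else -1

lemma measurable_delayField (T : ℕ) : Measurable (delayField T) :=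
  Measurable.ite measurableSet_Iio measurable_const measurable_const

/-- The only neighbour outside the branch is `δ.1`, attached to the root, so its spin is the root
field. -/
lemma IsSkeleton.branch (hreg : G.IsRegularOfDegree (m + 1)) {δ : V × V} (hδ : G.Adj δ.1 δ.2)
    {w : GlauberSample V} {a : V → ℕ → Spin} (ha : IsSkeleton (nbrs G) (fun _ _ => 0) w a) :
    IsSkeleton (rootedNbrs m) (rootField m fun t => a δ.1 (ringCount w δ.1 t))
      (pullSample (branch G δ) w) fun l => a (branch G δ l) := by
  refine ha.pull _ fun l t => ?_
  rw [localField, add_zero]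
  cases l with
  | nil => rw [sum_nbrs_branch_nil hreg hδ, sum_rootedNbrs_nil, add_comm]; rfl
  | cons i l =>
    rw [sum_nbrs_branch_cons hreg hδ, sum_rootedNbrs_cons]
    exact (add_zero _).symm

lemma IsSkeleton.subtree {η : ℝ → ℤ} {w : GlauberSample (List (Fin m))}
    {a : List (Fin m) → ℕ → Spin} (ha : IsSkeleton (rootedNbrs m) (rootField m η) w a)
    (i : Fin m) :
    IsSkeleton (rootedNbrs m) (rootField m fun t => a [] (ringCount w [] t))
      (pullSample (fun l => l ++ [i]) w) fun l => a (l ++ [i]) := by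
  refine ha.pull _ fun l t => ?_
  rw [localField]
  cases l with
  | nil =>
    rw [List.nil_append, sum_rootedNbrs_cons, sum_rootedNbrs_nil, add_comm (_ : ℤ) (∑ j, _)]
    exact add_zero _
  | cons j l =>
    rw [List.cons_append, sum_rootedNbrs_cons, sum_rootedNbrs_cons]
    rfl

lemma wellFounded_branch (hreg : G.IsRegularOfDegree (m + 1)) {δ : V × V} (hδ : G.Adj δ.1 δ.2)
    {w : GlauberSample V} (hw : WellFounded (SpinDep (nbrs G) w)) :
    WellFounded (SpinDep (rootedNbrs m) (pullSample (branch G δ) w)) :=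
  wellFounded_spinDep_pull hw _ (branch_adj_of_mem hreg hδ)

lemma measurePreserving_branch (hG : G.IsTree) (hreg : G.IsRegularOfDegree (m + 1)) {δ : V × V}
    (hδ : G.Adj δ.1 δ.2) : MeasurePreserving (pullSample (branch G (m := m) δ)) (glauberLaw V)
      (glauberLaw (List (Fin m))) :=
  measurePreserving_pullSample (branch_injective hG hreg hδ)

lemma glauberLaw_branchSet_neg {η : ℝ → ℤ} (hη : Measurable η) (s : Spin) :
    glauberLaw (List (Fin m)) (branchSet m (fun t => -η t) (-s)) =
      glauberLaw (List (Fin m)) (branchSet m η s) := by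
  rw [branchSet, rootField_neg]
  exact glauberLaw_settleSet_flip _ (measurable_rootField hη) _ _

/-- If an edge can end up with different spins, then a root settles at `1` with positive probability
under some field that is eventually `-1`. -/
lemma exists_delayField_pos (hG : G.IsTree) (hreg : G.IsRegularOfDegree (m + 1)) {δ : V × V}
    (hδ : G.Adj δ.1 δ.2)
    (h : glauberLaw V (settleSet (nbrs G) (fun _ _ => 0) δ.1 (-1) ∩
      settleSet (nbrs G) (fun _ _ => 0) δ.2 1) ≠ 0) :
    ∃ T, glauberLaw (List (Fin m)) (branchSet m (delayField T) 1) ≠ 0 := by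
  by_contra! hc
  refine h (measure_mono_null_ae ?_ (measure_iUnion_null fun T =>
    ((measurePreserving_branch hG hreg hδ).measure_preimage
      (measurableSet_branchSet (measurable_delayField T) 1).nullMeasurableSet).trans (hc T)))
  filter_upwards [ae_regular_wellFounded hG.connected hreg] with w ⟨hw, hwf⟩ hmem
  have h1 := (mem_settleSet_iff hwf _ _).1 hmem.1
  have h2 := (mem_settleSet_iff hwf _ _).1 hmem.2
  obtain ⟨T₀, hT₀⟩ := eventually_atTop.1 ((hw.tendsto_ringCount δ.1).eventually h1)
  obtain ⟨T, hT⟩ := exists_nat_ge T₀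
  refine Set.mem_iUnion.2 ⟨T, ?_⟩
  have hwf' := wellFounded_branch (m := m) hreg hδ hwf
  refine (mem_settleSet_iff hwf' _ _).2 (h2.mono fun k => ?_)
  refine ((isSkeleton_skeleton hwf).branch hreg hδ).le hwf' (isSkeleton_skeleton hwf')
    (fun l j => rootField_mono (fun t _ => ?_) l ((hw.pos _ j))) [] k
  -- Before `T` the spin at `δ.1` is at most 1; from `T` on it equals -1.
  unfold delayField
  split_ifs with ht
  · exact Spin.le_one _
  · rw [hT₀ t (hT.trans (not_lt.1 ht))]
    simp

end BranchDynamics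

/-! ### Vertices that cannot settle -/

section Blinkers

open scoped ENNReal

variable {V : Type*} {G : SimpleGraph V} [G.LocallyFinite] {m : ℕ}

variable (G) in
/-- The vertices of the branch at `δ` that lie in the subtree rooted at `l₀`. -/
def subtreeSites (δ : V × V) (l₀ : List (Fin m)) : Set V := Set.range fun l => branch G δ (l ++ l₀)

variable (G) in
/-- The event that the subtree at `l₀` of the branch at `δ` realises the event `B`. -/
def subtreeEvent (δ : V × V) (l₀ : List (Fin m)) (B : Set (GlauberSample (List (Fin m)))) :
    Set (GlauberSample V) :=
  pullSample (branch G (branchDart G δ l₀)) ⁻¹' B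

lemma disjoint_subtreeSites (hG : G.IsTree) (hreg : G.IsRegularOfDegree (m + 1)) {δ : V × V}
    (hδ : G.Adj δ.1 δ.2) {l₀ l₁ : List (Fin m)} (h : ∀ l l', l ++ l₀ ≠ l' ++ l₁) :
    Disjoint (subtreeSites G δ l₀) (subtreeSites G δ l₁) := by
  refine Set.disjoint_left.2 ?_
  rintro _ ⟨l, rfl⟩ ⟨l', hl'⟩
  exact h l l' (branch_injective hG hreg hδ hl').symm

lemma subtreeSites_append_subset (δ : V × V) (l l₀ : List (Fin m)) :
    subtreeSites G δ (l ++ l₀) ⊆ subtreeSites G δ l₀ := by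
  rintro _ ⟨l', rfl⟩
  exact ⟨l' ++ l, by simp only [List.append_assoc]⟩

lemma measurableSet_subtreeEvent (δ : V × V) (l₀ : List (Fin m))
    {B : Set (GlauberSample (List (Fin m)))} (hB : MeasurableSet B) :
    MeasurableSet[siteAlg (subtreeSites G δ l₀)] (subtreeEvent G δ l₀ B) :=
  measurable_pullSample_siteAlg (S := subtreeSites G δ l₀) _
    (fun l => ⟨l, branch_append δ l l₀⟩) hB

lemma glauberLaw_subtreeEvent (hG : G.IsTree) (hreg : G.IsRegularOfDegree (m + 1)) {δ : V × V}
    (hδ : G.Adj δ.1 δ.2) (l₀ : List (Fin m)) {B : Set (GlauberSample (List (Fin m)))}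
    (hB : MeasurableSet B) :
    glauberLaw V (subtreeEvent G δ l₀ B) = glauberLaw (List (Fin m)) B :=
  (measurePreserving_branch hG hreg (branchDart_adj hreg hδ l₀)).measure_preimage
    hB.nullMeasurableSet

/-- The event that `v` starts with spin `1` and that its clock does not ring up to time `T`. -/
def quietSet (T : ℕ) (v : V) : Set (GlauberSample V) := {w | (w v).1 = 1 ∧ (T : ℝ) < (w v).2.1 0}

lemma measurableSet_quietSet (T : ℕ) (v : V) : MeasurableSet[siteAlg {v}] (quietSet T v) := by
  have h : MeasurableSet {x : Spin × (ℕ → ℝ) × (ℕ → Spin) | x.1 = 1 ∧ (T : ℝ) < x.2.1 0} :=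
    (measurable_fst (measurableSet_singleton 1)).inter (measurableSet_lt measurable_const
      ((measurable_pi_apply 0).comp (measurable_fst.comp measurable_snd)))
  exact measurable_site (Set.mem_singleton v) h

lemma glauberLaw_quietSet_ne_zero (T : ℕ) (v : V) : glauberLaw V (quietSet T v) ≠ 0 := by
  have hp : MeasurePreserving (fun x : Spin × (ℕ → ℝ) × (ℕ → Spin) => (x.1, x.2.1)) siteLaw
      (fairSpin.prod clockLaw) := (MeasurePreserving.id fairSpin).prod measurePreserving_fst
  have hset : quietSet T v = ((fun x : Spin × (ℕ → ℝ) × (ℕ → Spin) => (x.1, x.2.1)) ∘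
      fun w : GlauberSample V => w v) ⁻¹' ({1} ×ˢ ((fun x : ℕ → ℝ => x 0) ⁻¹' Set.Ioi (T : ℝ))) := rfl
  have hm : MeasurableSet ((fun x : ℕ → ℝ => x 0) ⁻¹' Set.Ioi (T : ℝ)) :=
    measurable_pi_apply 0 measurableSet_Ioi
  rw [hset, (hp.comp (measurePreserving_site v)).measure_preimage
    ((measurableSet_singleton 1).prod hm).nullMeasurableSet, Measure.prod_prod,
    (measurePreserving_wait 0).measure_preimage measurableSet_Ioi.nullMeasurableSet,
    fairSpin_singleton]
  refine mul_ne_zero (by simp) ?_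
  rw [← Set.compl_Iic, prob_compl_eq_one_sub measurableSet_Iic]
  exact (tsub_pos_of_lt (expMeasure_one_Iic_lt_one _)).ne'

/-- Once all `m` children are 1, the field at the root is `m - 1`, which is positive. -/
lemma settles_root_of_children {w : GlauberSample (List (Fin m))} (hm : 1 < m)
    (hw : RegularClocks w) {a : List (Fin m) → ℕ → Spin}
    (ha : IsSkeleton (rootedNbrs m) (rootField m fun _ => -1) w a)
    (h : ∀ i, Settles a [i] 1) : Settles a [] 1 := by
  have h' := eventually_all.2 fun i => ((hw.tendsto_ringCount [i]).comp
    (hw.tendsto [])).eventually (h i)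
  obtain ⟨K, hK⟩ := eventually_atTop.1 h'
  refine eventually_atTop.2 ⟨K + 1, fun k hk => ?_⟩
  obtain ⟨j, rfl⟩ : ∃ j, k = j + 1 := ⟨k - 1, by omega⟩
  rw [ha.succ]
  refine heatBath_of_pos ?_ _
  have hsum : ∑ i : Fin m, (a [i] (ringCount w [i] (w.ringTime [] j)) : ℤ) = m := by
    rw [Finset.sum_congr rfl fun i _ => by rw [show a [i] (ringCount w [i] (w.ringTime [] j)) = 1
      from hK j (by omega) i]]
    simp
  rw [localField, sum_rootedNbrs_nil, hsum, rootField]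
  omega

/-- If the root can settle at `1` under a delayed field, then also under the field `-1`. -/
lemma branchSet_neg_one_ne_zero (hG : G.IsTree) (hreg : G.IsRegularOfDegree (m + 1))
    (hm : 1 < m) {δ : V × V} (hδ : G.Adj δ.1 δ.2) {T : ℕ}
    (h : glauberLaw (List (Fin m)) (branchSet m (delayField T) 1) ≠ 0) :
    glauberLaw (List (Fin m)) (branchSet m (fun _ => -1) 1) ≠ 0 := by
  -- The index `none` stands for the quiet root, `some i` for the subtree of its `i`-th child; these
  -- sets of sites are disjoint.
  set S : Option (Fin m) → Set V := fun x =>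
    x.elim {branch G δ ([] : List (Fin m))} fun i => subtreeSites G δ [i] with hS
  set A : Option (Fin m) → Set (GlauberSample V) := fun x =>
    x.elim (quietSet T (branch G δ ([] : List (Fin m)))) fun i =>
      subtreeEvent G δ [i] (branchSet m (delayField T) 1) with hA
  have hroot : ∀ i : Fin m, Disjoint {branch G δ ([] : List (Fin m))} (subtreeSites G δ [i]) := by
    refine fun i => Set.disjoint_singleton_left.2 ?_
    rintro ⟨l, hl⟩
    simpa using branch_injective hG hreg hδ hl
  have hdisj : Pairwise fun x y => Disjoint (S x) (S y) := by
    rintro (_ | i) (_ | j) hij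
    · exact absurd rfl hij
    · exact hroot j
    · exact (hroot i).symm
    · refine disjoint_subtreeSites hG hreg hδ fun l l' hl => hij ?_
      have := (List.append_inj' hl rfl).2
      simpa using this
  have hB := measurableSet_branchSet (m := m) (measurable_delayField T) 1
  have hAm : ∀ x, MeasurableSet[siteAlg (S x)] (A x) := by
    rintro (_ | i)
    · exact measurableSet_quietSet T _
    · exact measurableSet_subtreeEvent δ [i] hB
  have hpos : glauberLaw V (⋂ x ∈ Finset.univ, A x) ≠ 0 := by
    rw [glauberLaw_biInter Finset.univ S hdisj A hAm, Finset.prod_ne_zero_iff]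
    rintro (_ | i) -
    · exact glauberLaw_quietSet_ne_zero T _
    · exact (glauberLaw_subtreeEvent hG hreg hδ [i] hB).trans_ne h
  -- The comparison takes place in a branch of `G`, where regular clocks and well-foundedness are
  -- inherited from `G`.
  rw [← (measurePreserving_branch hG hreg hδ).measure_preimage
    (measurableSet_branchSet measurable_const 1).nullMeasurableSet]
  refine fun h0 => hpos (measure_mono_null_ae ?_ h0)
  filter_upwards [ae_regular_wellFounded hG.connected hreg] with w ⟨hw, hwf⟩ hmem
  have hmem : w ∈ ⋂ x ∈ Finset.univ, A x := hmem
  simp only [Finset.mem_univ, Set.iInter_true, Set.mem_iInter] at hmem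
  set w' := pullSample (branch G (m := m) δ) w with hw'
  have hreg' : RegularClocks w' := hw.pull (branch_injective hG hreg hδ)
  have hwf' : WellFounded (SpinDep (rootedNbrs m) w') := wellFounded_branch hreg hδ hwf
  have ha := isSkeleton_skeleton (e := rootField m fun _ => -1) hwf'
  refine (mem_settleSet_iff hwf' _ _).2 (settles_root_of_children hm hreg' ha fun i => ?_)
  have hquiet : w ∈ quietSet T (branch G δ ([] : List (Fin m))) := hmem none
  have hi : pullSample (branch G (branchDart G δ [i])) w ∈ branchSet m (delayField T) 1 :=
    hmem (some i)
  have hpull : pullSample (fun l => l ++ [i]) w' = pullSample (branch G (branchDart G δ [i])) w := by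
    funext l
    exact congrArg w (branch_append δ l [i])
  have hwfi : WellFounded (SpinDep (rootedNbrs m) (pullSample (fun l => l ++ [i]) w')) := by
    rw [hpull]
    exact wellFounded_branch hreg (branchDart_adj hreg hδ [i]) hwf
  rw [← hpull, branchSet, mem_settleSet_iff hwfi] at hi
  refine hi.mono fun k => ?_
  refine (isSkeleton_skeleton hwfi).le hwfi (ha.subtree i)
    (fun l j => rootField_mono (fun t ht => ?_) l (hreg'.pos _ j)) [] k
  -- The quiet root still shows its initial spin 1 before `T`, and is at least -1 later, so it
  -- dominates the delayed field felt by its children.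
  unfold delayField
  split_ifs with htT
  · have h0 : ringCount w' [] t = 0 := by
      refine Nat.le_zero.1 (hreg'.ringCount_le_iff.2 ?_)
      rw [GlauberSample.ringTime, zero_add, Finset.sum_range_one]
      exact htT.trans hquiet.2
    rw [h0, ha.zero]
    exact (congrArg (fun s : Spin => (s : ℤ)) hquiet.1).ge
  · exact Spin.neg_one_le _

/-- The constant field -1 is the least that the parent can exert, so monotonicity gives the claim
for the true dynamics. -/
lemma settles_of_subtreeEvent_one (hreg : G.IsRegularOfDegree (m + 1)) {δ : V × V}
    (hδ : G.Adj δ.1 δ.2) {w : GlauberSample V} (hw : RegularClocks w)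
    (hwf : WellFounded (SpinDep (nbrs G) w)) {l : List (Fin m)}
    (h : w ∈ subtreeEvent G δ l (branchSet m (fun _ => -1) 1)) :
    Settles (skeleton (nbrs G) (fun _ _ => 0) w) (branch G δ l) 1 := by
  have hδ' := branchDart_adj hreg hδ l
  have hwf' := wellFounded_branch (m := m) hreg hδ' hwf
  refine ((mem_settleSet_iff hwf' _ _).1 h).mono fun k => ?_
  exact (isSkeleton_skeleton hwf').le hwf' ((isSkeleton_skeleton hwf).branch hreg hδ')
    (fun _ j => rootField_mono (fun _ _ => Spin.neg_one_le _) _ (hw.pos _ j)) [] k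

lemma settles_of_subtreeEvent_neg_one (hreg : G.IsRegularOfDegree (m + 1)) {δ : V × V}
    (hδ : G.Adj δ.1 δ.2) {w : GlauberSample V} (hw : RegularClocks w)
    (hwf : WellFounded (SpinDep (nbrs G) w)) {l : List (Fin m)}
    (h : w ∈ subtreeEvent G δ l (branchSet m (fun _ => 1) (-1))) :
    Settles (skeleton (nbrs G) (fun _ _ => 0) w) (branch G δ l) (-1) := by
  have hδ' := branchDart_adj hreg hδ l
  have hwf' := wellFounded_branch (m := m) hreg hδ' hwf
  refine ((mem_settleSet_iff hwf' _ _).1 h).anti fun k => ?_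
  exact ((isSkeleton_skeleton hwf).branch hreg hδ').le hwf' (isSkeleton_skeleton hwf')
    (fun _ j => rootField_mono (fun _ _ => Spin.le_one _) _ (hw.pos _ j)) [] k

/-- The branch settles at `s` whatever happens outside it. -/
def forcedSet (m : ℕ) (s : Spin) : Set (GlauberSample (List (Fin m))) :=
  branchSet m (fun _ => -(s : ℤ)) s

lemma settles_of_forcedSet (hreg : G.IsRegularOfDegree (m + 1)) {δ : V × V}
    (hδ : G.Adj δ.1 δ.2) {w : GlauberSample V} (hw : RegularClocks w)
    (hwf : WellFounded (SpinDep (nbrs G) w)) {l : List (Fin m)} {s : Spin}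
    (h : w ∈ subtreeEvent G δ l (forcedSet m s)) :
    Settles (skeleton (nbrs G) (fun _ _ => 0) w) (branch G δ l) s := by
  rcases Int.units_eq_one_or s with rfl | rfl
  · exact settles_of_subtreeEvent_one hreg hδ hw hwf h
  · refine settles_of_subtreeEvent_neg_one hreg hδ hw hwf ?_
    simpa [forcedSet] using h

lemma glauberLaw_forcedSet (m : ℕ) (s : Spin) :
    glauberLaw (List (Fin m)) (forcedSet m s) =
      glauberLaw (List (Fin m)) (branchSet m (fun _ => -1) 1) := by
  rcases Int.units_eq_one_or s with rfl | rfl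
  · rfl
  · rw [← glauberLaw_branchSet_neg measurable_const 1]
    rfl

/-- Spins of the children which, together with a parent of spin `-s`, produce a tie. -/
def tieSpin (h : ℕ) (s : Spin) (j : Fin (h + 1 + h)) : Spin := if (j : ℕ) < h + 1 then s else -s

lemma sum_tieSpin (h : ℕ) (s : Spin) : ∑ j, (tieSpin h s j : ℤ) = s := by
  have h1 : ∀ i : Fin (h + 1), tieSpin h s (Fin.castAdd h i) = s := fun i => by
    simp [tieSpin, Nat.lt_succ_iff.1 i.2]
  have h2 : ∀ i : Fin h, tieSpin h s (Fin.natAdd (h + 1) i) = -s := fun i =>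
    if_neg (by rw [Fin.val_natAdd]; omega)
  rw [Fin.sum_univ_add]
  simp only [h1, h2]
  simp
  ring

/-- Position of the `j`-th child of the `s`-th child. -/
def grandchild (h : ℕ) (hh : 0 < h) (x : Spin × Fin (h + 1 + h)) : List (Fin (h + 1 + h)) :=
  [x.2, if x.1 = 1 then ⟨0, by omega⟩ else ⟨1, by omega⟩]

lemma grandchild_injective (h : ℕ) (hh : 0 < h) : Function.Injective (grandchild h hh) := by
  rintro ⟨s, i⟩ ⟨s', j⟩ hij
  simp only [grandchild, List.cons.injEq, and_true] at hij
  obtain ⟨rfl, h2⟩ := hij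
  rcases Int.units_eq_one_or s with rfl | rfl <;> rcases Int.units_eq_one_or s' with rfl | rfl <;>
    first | rfl | (exfalso; revert h2; simp [show (-1 : Spin) ≠ 1 by decide])

variable (G) in
/-- The grandchildren of the vertex at `l₀` are forced to settle in such a way that one of the
first two children of this vertex never settles. -/
def blinkSet (h : ℕ) (hh : 0 < h) (δ : V × V) (l₀ : List (Fin (h + 1 + h))) :
    Set (GlauberSample V) :=
  ⋂ x ∈ (Finset.univ : Finset (Spin × Fin (h + 1 + h))),
    subtreeEvent G δ (grandchild h hh x ++ l₀) (forcedSet (h + 1 + h) (tieSpin h x.1 x.2))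

lemma measurableSet_blinkSet (h : ℕ) (hh : 0 < h) (δ : V × V) (l₀ : List (Fin (h + 1 + h))) :
    MeasurableSet[siteAlg (subtreeSites G δ l₀)] (blinkSet G h hh δ l₀) := by
  refine Finset.measurableSet_biInter (m := siteAlg (subtreeSites G δ l₀)) _ fun x _ => ?_
  exact siteAlg_mono (subtreeSites_append_subset δ _ l₀) _ (measurableSet_subtreeEvent δ _
    (measurableSet_branchSet measurable_const _))

lemma glauberLaw_blinkSet (hG : G.IsTree) (h : ℕ) (hh : 0 < h)
    (hreg : G.IsRegularOfDegree (h + 1 + h + 1)) {δ : V × V} (hδ : G.Adj δ.1 δ.2)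
    (l₀ : List (Fin (h + 1 + h))) : glauberLaw V (blinkSet G h hh δ l₀) =
      glauberLaw (List (Fin (h + 1 + h))) (branchSet (h + 1 + h) (fun _ => -1) 1) ^
        (2 * (h + 1 + h)) := by
  have hm : ∀ s, MeasurableSet (forcedSet (h + 1 + h) s) := fun s =>
    measurableSet_branchSet measurable_const s
  rw [blinkSet, glauberLaw_biInter Finset.univ
    (fun x => subtreeSites G δ (grandchild h hh x ++ l₀)) ?_ _
    fun x => measurableSet_subtreeEvent δ _ (hm _)]
  · simp only [glauberLaw_subtreeEvent hG hreg hδ _ (hm _), glauberLaw_forcedSet]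
    rw [Finset.prod_const, Finset.card_univ, Fintype.card_prod, Fintype.card_fin,
      Fintype.card_units_int]
  · intro x y hxy
    refine disjoint_subtreeSites hG hreg hδ fun l l' hl => hxy (grandchild_injective h hh ?_)
    rw [← List.append_assoc, ← List.append_assoc, List.append_left_inj] at hl
    exact (List.append_inj' hl rfl).2

/-- The forced grandchildren contribute `s` to the field at the child assigned to `s`, for both
signs. The child whose sign opposes the limit at `l₀` then sees limiting field zero, which a frozen
state excludes. -/
lemma not_settles_of_blinkSet {h : ℕ} {hh : 0 < h} (hreg : G.IsRegularOfDegree (h + 1 + h + 1))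
    {δ : V × V} (hδ : G.Adj δ.1 δ.2) {w : GlauberSample V} (hw : RegularClocks w)
    (hwf : WellFounded (SpinDep (nbrs G) w))
    (hcoin : ∀ v (b : Spin), ∃ᶠ k in atTop, w.coin v k = b) {l₀ : List (Fin (h + 1 + h))}
    (hmem : w ∈ blinkSet G h hh δ l₀) :
    ¬ ∀ v, ∃ s, Settles (skeleton (nbrs G) (fun _ _ => 0) w) v s := by
  intro hfreeze
  choose l hl using hfreeze
  have hset : ∀ x : Spin × Fin (h + 1 + h),
      l (branch G δ (grandchild h hh x ++ l₀)) = tieSpin h x.1 x.2 := fun x =>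
    (hl _).unique (settles_of_forcedSet hreg hδ hw hwf (Set.mem_iInter₂.1 hmem x (Finset.mem_univ x)))
  set s : Spin := -l (branch G δ l₀) with hs
  set c : Fin (h + 1 + h) := if s = 1 then ⟨0, by omega⟩ else ⟨1, by omega⟩ with hc
  refine sum_ne_zero_of_settles hw hcoin (isSkeleton_skeleton hwf) hl (branch G δ (c :: l₀)) ?_
  rw [sum_nbrs_branch_cons hreg hδ (fun v => (l v : ℤ))]
  have hsum : ∑ j, (l (branch G δ (j :: c :: l₀)) : ℤ) = ∑ j, (tieSpin h s j : ℤ) :=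
    Finset.sum_congr rfl fun j _ => congrArg (fun s : Spin => (s : ℤ)) (hset (s, j))
  rw [hsum, sum_tieSpin, hs]
  simp

lemma replicate_append_cons_inj {α : Type*} {x y : α} (hxy : x ≠ y) {n n' : ℕ} {l l' : List α}
    (h : List.replicate n x ++ y :: l = List.replicate n' x ++ y :: l') : n = n' := by
  induction n generalizing n' with
  | zero =>
    cases n' with
    | zero => rfl
    | succ n' => exact absurd (List.cons.inj h).1.symm hxy
  | succ n ih =>
    cases n' with
    | zero => exact absurd (List.cons.inj h).1 hxy
    | succ n' => rw [ih (List.cons.inj h).2]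

/-- If roots can settle against their field, then almost surely some vertex does not settle. -/
lemma ae_not_settles_of_branchSet (hG : G.IsTree) {h : ℕ} (hh : 0 < h)
    (hreg : G.IsRegularOfDegree (h + 1 + h + 1)) {δ : V × V} (hδ : G.Adj δ.1 δ.2)
    (hpos : glauberLaw (List (Fin (h + 1 + h))) (branchSet (h + 1 + h) (fun _ => -1) 1) ≠ 0) :
    ∀ᵐ w ∂(glauberLaw V), ¬ ∀ v, ∃ s, Settles (skeleton (nbrs G) (fun _ _ => 0) w) v s := by
  have := countable_of_connected G hG.connected
  set p := glauberLaw (List (Fin (h + 1 + h))) (branchSet (h + 1 + h) (fun _ => -1) 1) ^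
    (2 * (h + 1 + h)) with hp
  have hp0 : p ≠ 0 := pow_ne_zero _ hpos
  -- Since the last entry is followed first, `r n` descends `n` times to child 0 and then to child
  -- 1: the subtrees hang off a ray and are disjoint.
  set r : ℕ → List (Fin (h + 1 + h)) := fun n =>
    ⟨1, by omega⟩ :: List.replicate n ⟨0, by omega⟩ with hr
  have hdisj : Pairwise fun n n' =>
      Disjoint (subtreeSites G δ (r n)) (subtreeSites G δ (r n')) := by
    refine fun n n' hn => disjoint_subtreeSites hG hreg hδ fun l l' hl => hn ?_
    have := congrArg List.reverse hl
    simp only [hr, List.reverse_append, List.reverse_cons, List.reverse_replicate,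
      List.append_assoc, List.singleton_append] at this
    exact replicate_append_cons_inj (by simp) this
  have hm : ∀ n, MeasurableSet (blinkSet G h hh δ (r n)) := fun n =>
    siteAlg_le _ _ (measurableSet_blinkSet h hh δ (r n))
  have hsome : ∀ᵐ w ∂(glauberLaw V), ∃ n, w ∈ blinkSet G h hh δ (r n) := by
    rw [ae_iff]
    refine le_antisymm (ge_of_tendsto' (ENNReal.tendsto_pow_atTop_nhds_zero_of_lt_one
      (r := 1 - p) (ENNReal.sub_lt_self ENNReal.one_ne_top one_ne_zero hp0)) fun N => ?_) zero_le
    -- Each subtree fails to blink with probability `1 - p`, independently of the others.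
    have hN : glauberLaw V (⋂ n ∈ Finset.range N, (blinkSet G h hh δ (r n))ᶜ) = (1 - p) ^ N := by
      rw [glauberLaw_biInter (Finset.range N) _ hdisj _
        fun n => (measurableSet_blinkSet h hh δ (r n)).compl]
      simp only [prob_compl_eq_one_sub (hm _), glauberLaw_blinkSet hG h hh hreg hδ, ← hp]
      simp
    rw [← hN]
    refine measure_mono fun w hw => ?_
    have hw : ¬ ∃ n, w ∈ blinkSet G h hh δ (r n) := hw
    exact Set.mem_iInter₂.2 fun n _ hn => hw ⟨n, hn⟩
  filter_upwards [hsome, ae_regular_wellFounded hG.connected hreg, ae_frequently_coin_eq]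
    with w ⟨n, hn⟩ ⟨hw, hwf⟩ hcoin
  exact not_settles_of_blinkSet hreg hδ hw hwf hcoin hn

end Blinkers

/-! ### The dynamics does not freeze -/

section Main

variable {V : Type*} {G : SimpleGraph V} [G.LocallyFinite]

/-- If limits agree across edges, connectedness makes the frozen state a consensus, which is null
for either sign. -/
lemma ae_not_settles_of_agree {m : ℕ} (hG : G.IsTree) (hreg : G.IsRegularOfDegree (m + 1))
    (hm : 0 < m)
    (h : ∀ᵐ w ∂(glauberLaw V), (∀ v, ∃ s, Settles (skeleton (nbrs G) (fun _ _ => 0) w) v s) →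
      ∀ o x, G.Adj o x → w ∉ settleSet (nbrs G) (fun _ _ => 0) o (-1) ∩
        settleSet (nbrs G) (fun _ _ => 0) x 1) :
    ∀ᵐ w ∂(glauberLaw V), ¬ ∀ v, ∃ s, Settles (skeleton (nbrs G) (fun _ _ => 0) w) v s := by
  have hc : ∀ s, ∀ᵐ w ∂(glauberLaw V), w ∉ ⋂ v, settleSet (nbrs G) (fun _ _ => 0) v s := fun s =>
    measure_eq_zero_iff_ae_notMem.1 (glauberLaw_consensus hG hreg hm s)
  filter_upwards [h, hc 1, hc (-1), ae_regular_wellFounded hG.connected hreg]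
    with w hw h1 h2 ⟨_, hwf⟩ hfreeze
  have hagree := hw hfreeze
  choose l hl using hfreeze
  have hmem : ∀ v, w ∈ settleSet (nbrs G) (fun _ _ => 0) v (l v) := fun v =>
    (mem_settleSet_iff hwf v (l v)).2 (hl v)
  have hadj : ∀ o x, G.Adj o x → l o = l x := by
    intro o x hox
    have ho := hmem o
    have hx := hmem x
    rcases Int.units_eq_one_or (l o) with h3 | h3 <;> rcases Int.units_eq_one_or (l x) with h4 | h4
    · rw [h3, h4]
    · rw [h3] at ho; rw [h4] at hx
      exact absurd ⟨hx, ho⟩ (hagree x o hox.symm)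
    · rw [h3] at ho; rw [h4] at hx
      exact absurd ⟨ho, hx⟩ (hagree o x hox)
    · rw [h3, h4]
  obtain ⟨o⟩ := hG.connected.nonempty
  have hconst : ∀ v, l v = l o := by
    intro v
    obtain ⟨p⟩ := hG.connected.preconnected v o
    induction p with
    | nil => rfl
    | cons hvy _ ih => exact (hadj _ _ hvy).trans ih
  have hall : w ∈ ⋂ v, settleSet (nbrs G) (fun _ _ => 0) v (l o) :=
    Set.mem_iInter.2 fun v => hconst v ▸ hmem v
  rcases Int.units_eq_one_or (l o) with h3 | h3
  · exact h1 (h3 ▸ hall)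
  · exact h2 (h3 ▸ hall)

lemma ae_not_settles (hG : G.IsTree) {d : ℕ} (hd : Even d) (hreg : G.IsRegularOfDegree d) :
    ∀ᵐ w ∂(glauberLaw V), ¬ ∀ v, ∃ s, Settles (skeleton (nbrs G) (fun _ _ => 0) w) v s := by
  have := countable_of_connected G hG.connected
  obtain ⟨h, rfl⟩ := hd
  rcases h with _ | h
  -- Degree 0: an isolated vertex is tied at every ring.
  · obtain ⟨o⟩ := hG.connected.nonempty
    filter_upwards [ae_regular_wellFounded hG.connected hreg, ae_frequently_coin_eq]
      with w ⟨hw, hwf⟩ hcoin hfreeze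
    choose l hl using hfreeze
    refine sum_ne_zero_of_settles hw hcoin (isSkeleton_skeleton hwf) hl o ?_
    have hempty : nbrs G o = ∅ := by
      rw [nbrs, ← Finset.card_eq_zero, G.card_neighborFinset_eq_degree, hreg o]
    rw [hempty, Finset.sum_empty]
  · have hreg' : G.IsRegularOfDegree (h + 1 + h + 1) := by
      convert hreg using 1
      omega
    by_cases hedge : ∀ o x, G.Adj o x → glauberLaw V (settleSet (nbrs G) (fun _ _ => 0) o (-1) ∩
        settleSet (nbrs G) (fun _ _ => 0) x 1) = 0
    · refine ae_not_settles_of_agree hG hreg' (by omega) ?_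
      have : ∀ᵐ w ∂(glauberLaw V), ∀ o x, G.Adj o x → w ∉ settleSet (nbrs G) (fun _ _ => 0) o (-1) ∩
          settleSet (nbrs G) (fun _ _ => 0) x 1 :=
        ae_all_iff.2 fun o => ae_all_iff.2 fun x => Filter.eventually_imp_distrib_left.2 fun hox =>
          measure_eq_zero_iff_ae_notMem.1 (hedge o x hox)
      filter_upwards [this] with w hw _ using hw
    · push Not at hedge
      obtain ⟨o, x, hox, hne⟩ := hedge
      rcases Nat.eq_zero_or_pos h with rfl | hh
      -- Degree 2: a limit of 1 needs a positive neighbour sum, which is impossible with one of the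
      -- two neighbours at -1. So opposite limits on an edge cannot occur in a frozen state.
      · refine ae_not_settles_of_agree hG hreg' (by omega) ?_
        filter_upwards [ae_regular_wellFounded hG.connected hreg, ae_frequently_coin_eq]
          with w ⟨hw, hwf⟩ hcoin hfreeze o x hox hmem
        choose l hl using hfreeze
        have ho := (hl o).unique ((mem_settleSet_iff hwf _ _).1 hmem.1)
        have hx := (hl x).unique ((mem_settleSet_iff hwf _ _).1 hmem.2)
        have hpos := sum_pos_of_settles hw hcoin (isSkeleton_skeleton hwf) hl x hx
        rw [nbrs, sum_neighbors_eq (m := 1) hreg' hox, ho, Fin.sum_univ_one] at hpos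
        have := Spin.le_one (l (child G 1 o x 0))
        simp only [Units.val_neg, Units.val_one] at hpos
        omega
      · obtain ⟨T, hT⟩ := exists_delayField_pos (δ := (o, x)) hG hreg' hox hne
        exact ae_not_settles_of_branchSet (δ := (o, x)) hG hh hreg' hox
          (branchSet_neg_one_ne_zero (δ := (o, x)) hG hreg' (by omega) hox hT)

end Main

theorem mainTheorem2 {V : Type*} (G : SimpleGraph V) [G.LocallyFinite] (hG : G.IsTree)
    (d : ℕ) (hd : Even d) (hreg : G.IsRegularOfDegree d) :
    ∀ᵐ w ∂(glauberLaw V), ∃ σ : ℝ≥0 → V → Spin,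
      IsGlauberEvolution G w σ ∧
      (∀ σ' : ℝ≥0 → V → Spin, IsGlauberEvolution G w σ' → σ' = σ) ∧
      ¬ Freezes σ ∧
      ∃ v : V, (flipTimes σ v).Infinite := by
  filter_upwards [ae_regular_wellFounded hG.connected hreg, ae_not_settles hG hd hreg]
    with w ⟨hw, hwf⟩ h
  exact exists_unique_evolution hw hwf h
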